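/- For distinct non-adjacent vertices $s,t$ of a finite simple graph $G$, an $st$-separator is a set $S\subseteq V(G)\setminus\{s,t\}$ such that $G-S$ contains no path from $s$ to $t$; it is minimal if no proper subset of it is an $st$-separator. A minimal vertex separator of $G$ is a set that is a minimal $st$-separator for some pair $s,t$. A class $\mathcal G$ of finite simple graphs is tame if there is a polynomial $q$ such that every $G\in\mathcal G$ has at most $q(|V(G)|)$ minimal vertex separators. Two $st$-separators $S,S'$ are adjacent under TJ if $|S|=|S'|$ and $|S\setminus S'|=|S'\setminus S|=1$, and adjacent under $k$-TAR if $|S\,\triangle\, S'|=1$ and $\max(|S|,|S'|)\le k$. Vertex Separator Reconfiguration under TJ (respectively TAR) asks, given $G$, $s,t$ and two $st$-separators $S_a,S_b$ (and, for TAR, an integer $k\ge 0$), whether there is a finite sequence of $st$-separators from $S_a$ to $S_b$ in which consecutive members are adjacent under TJ (respectively $k$-TAR). **Theorem.** Let $\mathcal G$ be a tame class. Then Vertex Separator Reconfiguration on graphs $G\in\mathcal G$ can be solved in time polynomial in $|V(G)|$ under TAR, and also under TJ (on a random access machine that charges one step for each addition, truncated subtraction, memory access or test, and that has no multiplication). Moreover,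 let $G \in \mathcal G$, let $u,v$ be vertices of $G$, let $S_a,S_b$ be $uv$-separators of $G$ with $|S_a|,|S_b|\le k$, and let $H_{uv}$ be the graph whose vertices are the minimal $uv$-separators of $G$, two distinct ones being adjacent if and only if their union has at most $k$ elements. Then for all minimal $uv$-separators $S_a'\subseteq S_a$ and $S_b'\subseteq S_b$, the separator $S_a$ can be reconfigured into $S_b$ under $k$-TAR if and only if $S_a'$ and $S_b'$ lie in the same connected component of $H_{uv}$. -/

import Mathlib

namespace SepReconf

/-! ### Separators and their reconfiguration -/

section Graphs

variable {V : Type*}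

/-- `S` is an `st`-separator of `G`: it avoids `s` and `t`, and there is no path from `s` to `t`
in `G - S`. Such a set exists only if `s` and `t` are distinct and non-adjacent. -/
def IsSeparator (G : SimpleGraph V) (s t : V) (S : Finset V) : Prop :=
  ∃ (hs : s ∉ S) (ht : t ∉ S), ¬ (G.induce {v | v ∉ S}).Reachable ⟨s, hs⟩ ⟨t, ht⟩

/-- `S` is a minimal `st`-separator: an `st`-separator with no `st`-separator as a proper subset. -/
def IsMinSeparator (G : SimpleGraph V) (s t : V) (S : Finset V) : Prop :=
  Minimal (IsSeparator G s t) S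

/-- The family of all minimal vertex separators of `G`, over all pairs of vertices. -/
def minSeparators (G : SimpleGraph V) : Set (Finset V) :=
  {S | ∃ s t : V, IsMinSeparator G s t S}

variable [DecidableEq V]

/-- One step under `k`-TAR: one token is added or removed, both states having at most `k` tokens. -/
def TARStep (k : ℕ) (S T : Finset V) : Prop :=
  (symmDiff S T).card = 1 ∧ max S.card T.card ≤ k

/-- One step under TJ: one token jumps to another vertex. -/
def TJStep (S T : Finset V) : Prop :=
  S.card = T.card ∧ (S \ T).card = 1 ∧ (T \ S).card = 1

/-- `A` can be turned into `B` by a finite sequence of steps, all states being `st`-separators. -/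
def Reconfigurable (G : SimpleGraph V) (s t : V) (step : Finset V → Finset V → Prop)
    (A B : Finset V) : Prop :=
  Relation.ReflTransGen
    (fun S T => IsSeparator G s t S ∧ IsSeparator G s t T ∧ step S T) A B

/-- The instance `TAR(G, A, B, k)` (for the pair `s, t`) is positive. -/
def TAR (G : SimpleGraph V) (s t : V) (A B : Finset V) (k : ℕ) : Prop :=
  Reconfigurable G s t (TARStep k) A B

/-- The instance `TJ(G, A, B)` (for the pair `s, t`) is positive. -/
def TJ (G : SimpleGraph V) (s t : V) (A B : Finset V) : Prop :=
  Reconfigurable G s t TJStep A B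

/-- The graph on the minimal `st`-separators of `G` in which two distinct ones are adjacent if and
only if their union has at most `k` elements. -/
def overlapGraph (G : SimpleGraph V) (s t : V) (k : ℕ) :
    SimpleGraph {S : Finset V // IsMinSeparator G s t S} where
  Adj A B := A ≠ B ∧ (A.1 ∪ B.1).card ≤ k
  symm := ⟨fun _ _ h => ⟨h.1.symm, by rw [Finset.union_comm]; exact h.2⟩⟩
  loopless := ⟨fun _ h => h.1 rfl⟩

end Graphs

/-- A class of finite simple graphs, the vertices of an `n`-vertex graph being labelled by
`0, …, n - 1`. The class need not be closed under isomorphism. -/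
abbrev GraphClass : Type := ∀ n : ℕ, Set (SimpleGraph (Fin n))

/-- The number of minimal vertex separators of each graph of the class is bounded by a polynomial
evaluated at its number of vertices. -/
def Tame (𝒢 : GraphClass) : Prop :=
  ∃ p : Polynomial ℕ, ∀ (n : ℕ) (G : SimpleGraph (Fin n)), G ∈ 𝒢 n →
    (minSeparators G).ncard ≤ p.eval n

/-! ### The machine model

A random access machine with structured control, at unit cost, whose only arithmetic operations are
addition and truncated subtraction. There is no multiplication, so that an execution of `τ` steps
lengthens numbers by `O(τ)` bits, and polynomial time is the same as on a Turing machine. -/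

/-- The memory: `σ a i` is the content of cell `i` of array number `a`. A program mentions only
finitely many arrays. -/
abbrev Store : Type := ℕ → ℕ → ℕ

/-- Expressions over natural numbers. -/
inductive Expr : Type
  | const (c : ℕ) : Expr
  | read (a : ℕ) (i : Expr) : Expr
  | add (e f : Expr) : Expr
  | sub (e f : Expr) : Expr

/-- The value of an expression. -/
def Expr.eval (σ : Store) : Expr → ℕ
  | .const c => c
  | .read a i => σ a (i.eval σ)
  | .add e f => e.eval σ + f.eval σ
  | .sub e f => e.eval σ - f.eval σ

/-- The number of steps that the evaluation of an expression takes: one for each operation. -/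
def Expr.cost : Expr → ℕ
  | .const _ => 1
  | .read _ i => i.cost + 1
  | .add e f => e.cost + f.cost + 1
  | .sub e f => e.cost + f.cost + 1

/-- Programs. A condition is an expression, and it holds if its value is not zero. -/
inductive Prog : Type
  | skip : Prog
  | write (a : ℕ) (i e : Expr) : Prog
  | seq (p q : Prog) : Prog
  | cond (c : Expr) (p q : Prog) : Prog
  | loop (c : Expr) (p : Prog) : Prog

/-- `Exec p σ τ σ'`: started in memory `σ`, the program `p` halts after exactly `τ` steps, in
memory `σ'`. -/
inductive Exec : Prog → Store → ℕ → Store → Prop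
  | skip (σ : Store) : Exec .skip σ 1 σ
  | write (a : ℕ) (i e : Expr) (σ : Store) :
      Exec (.write a i e) σ (i.cost + e.cost + 1)
        (Function.update σ a (Function.update (σ a) (i.eval σ) (e.eval σ)))
  | seq {p q : Prog} {σ σ' σ'' : Store} {τ τ' : ℕ} :
      Exec p σ τ σ' → Exec q σ' τ' σ'' → Exec (.seq p q) σ (τ + τ') σ''
  | cond_true {c : Expr} {p q : Prog} {σ σ' : Store} {τ : ℕ} :
      c.eval σ ≠ 0 → Exec p σ τ σ' → Exec (.cond c p q) σ (c.cost + 1 + τ) σ'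
  | cond_false {c : Expr} {p q : Prog} {σ σ' : Store} {τ : ℕ} :
      c.eval σ = 0 → Exec q σ τ σ' → Exec (.cond c p q) σ (c.cost + 1 + τ) σ'
  | loop_stop {c : Expr} {p : Prog} {σ : Store} :
      c.eval σ = 0 → Exec (.loop c p) σ (c.cost + 1) σ
  | loop_step {c : Expr} {p : Prog} {σ σ' σ'' : Store} {τ τ' : ℕ} :
      c.eval σ ≠ 0 → Exec p σ τ σ' → Exec (.loop c p) σ' τ' σ'' →
        Exec (.loop c p) σ (c.cost + 1 + τ + τ') σ''

open Classical in
/-- The initial memory for an instance: array `0` holds `n, s, t, k`, array `1` the adjacency matrix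
of `G` row by row, arrays `2` and `3` the characteristic vectors of `A` and `B`; all other cells
are zero. -/
noncomputable def encode {n : ℕ} (G : SimpleGraph (Fin n)) (s t : Fin n) (A B : Finset (Fin n))
    (k : ℕ) : Store
  | 0, 0 => n
  | 0, 1 => s
  | 0, 2 => t
  | 0, 3 => k
  | 1, x => if ∃ i j : Fin n, x = i.val * n + j.val ∧ G.Adj i j then 1 else 0
  | 2, x => if ∃ i : Fin n, x = i.val ∧ i ∈ A then 1 else 0
  | 3, x => if ∃ i : Fin n, x = i.val ∧ i ∈ B then 1 else 0
  | _, _ => 0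

/-- The program `p`, started in memory `σ`, halts after at most `m` steps, and it accepts (a nonzero
number is in cell `0` of array `0`) if and only if `answer` holds. -/
def DecidesWithin (p : Prog) (σ : Store) (m : ℕ) (answer : Prop) : Prop :=
  ∃ (τ : ℕ) (σ' : Store), Exec p σ τ σ' ∧ τ ≤ m ∧ (σ' 0 0 ≠ 0 ↔ answer)

/-- Vertex separator reconfiguration under TAR on the graphs of `𝒢` can be solved in polynomial
time: one program decides, for all graphs `G` of the class, all pairs `s, t`, all `st`-separators
`A, B` and all bounds `k`, whether `TAR(G, A, B, k)` is positive, within a number of steps that is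
polynomial in the number of vertices. -/
def TARPolyTimeSolvable (𝒢 : GraphClass) : Prop :=
  ∃ (p : Prog) (T : Polynomial ℕ), ∀ (n : ℕ) (G : SimpleGraph (Fin n)), G ∈ 𝒢 n →
    ∀ (s t : Fin n) (A B : Finset (Fin n)) (k : ℕ),
      IsSeparator G s t A → IsSeparator G s t B →
        DecidesWithin p (encode G s t A B k) (T.eval n) (TAR G s t A B k)

/-- The same for TJ. There is no bound `k` here, and its cell holds zero. -/
def TJPolyTimeSolvable (𝒢 : GraphClass) : Prop :=
  ∃ (p : Prog) (T : Polynomial ℕ), ∀ (n : ℕ) (G : SimpleGraph (Fin n)), G ∈ 𝒢 n →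
    ∀ (s t : Fin n) (A B : Finset (Fin n)),
      IsSeparator G s t A → IsSeparator G s t B →
        DecidesWithin p (encode G s t A B 0) (T.eval n) (TJ G s t A B)

end SepReconf

/-!
The criterion. Separators are closed under adding vertices other than `s` and `t`. Under `k`-TAR a
separator can therefore shrink to any minimal separator inside it, and two minimal separators are
joined through their union as soon as it has at most `k` vertices. Conversely, minimal separators
inside the two states of one step have a union of size at most `k`, because the union of the two
states is the larger of them (`TAR_iff_reachable`). For states of equal size `m`, TJ is the same as
`(m + 1)`-TAR: a union of `m + 1` vertices is crossed by one jump (`TJ_iff_TAR`).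

Listing the minimal `st`-separators. The one next to `s` is the part of `N(s)` seen from `t`. A
minimal separator `S` is pushed over `x ∈ S`, where `x` is not adjacent to `t`, by taking the part
of `N(A)` seen from `t`, where `A` is the component of `s` in `G - S` together with `x`. The result
is a minimal separator again (`IsMinSeparator.push`), and every minimal separator `T` is reached
(`mem_of_push_closed`): if the component of `t` in `G - S` still properly contains that of `G - T`,
then some `x ∈ S` lies on the side of `s` of `T`, and pushing over `x` does not cross `T`. No set
other than minimal `st`-separators is ever listed, so in a tame class a list of polynomial length is
complete (`isMinSeparator_iff_exists_row`).

The machine. `Comp C f` says that `f` is computable in polynomial time from data that are held in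
memory as prescribed by the context `C`. Such functions and properties are closed under addition,
truncated subtraction, connectives, sums and quantifiers over polynomially bounded ranges, and the
computation of a table row by row (`CompP.rows`). Reachability is a special case
(`CompRel.reflTransGen`), and so is the list of minimal separators. The programs are thus built
along with the proofs that they are correct and fast, and they stay implicit. Binders are treated
by quantifying over all contexts that extend the given one, which spares any renaming of variables.
The length of the list is a polynomial that depends on the class, and it is built into the program.
-/

namespace SepReconf

section Calculus

/-! ### Running programs within a time bound -/

/-- Total correctness with a time bound: started in `σ`, the program `p` halts after at most `m`
steps, in a memory satisfying `Q`. -/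
def Runs (p : Prog) (σ : Store) (m : ℕ) (Q : Store → Prop) : Prop :=
  ∃ (τ : ℕ) (σ' : Store), Exec p σ τ σ' ∧ τ ≤ m ∧ Q σ'

/-- Overwrite cell `i` of array `a` by `x`. -/
def Store.put (σ : Store) (a i x : ℕ) : Store :=
  Function.update σ a (Function.update (σ a) i x)

@[simp] theorem Store.put_same (σ : Store) (a i x : ℕ) : Store.put σ a i x a i = x := by
  simp [Store.put]

theorem Store.put_array (σ : Store) {a b : ℕ} (i x : ℕ) (h : b ≠ a) :
    Store.put σ a i x b = σ b := by
  simp [Store.put, h]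

theorem Store.put_cell (σ : Store) (a : ℕ) {i j : ℕ} (x : ℕ) (h : j ≠ i) :
    Store.put σ a i x a j = σ a j := by
  simp [Store.put, h]

theorem Runs.mono {p : Prog} {σ : Store} {m m' : ℕ} {Q Q' : Store → Prop} (h : Runs p σ m Q)
    (hm : m ≤ m') (hQ : ∀ σ', Q σ' → Q' σ') : Runs p σ m' Q' := by
  obtain ⟨τ, σ', h1, h2, h3⟩ := h
  exact ⟨τ, σ', h1, h2.trans hm, hQ _ h3⟩

theorem Runs.seq {p q : Prog} {σ : Store} {m m' : ℕ} {Q R : Store → Prop} (hp : Runs p σ m Q)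
    (hq : ∀ σ', Q σ' → Runs q σ' m' R) : Runs (.seq p q) σ (m + m') R := by
  obtain ⟨τ, σ', h1, h2, h3⟩ := hp
  obtain ⟨τ', σ'', h4, h5, h6⟩ := hq _ h3
  exact ⟨_, _, .seq h1 h4, by omega, h6⟩

theorem Runs.write {a : ℕ} {i e : Expr} {σ : Store} {Q : Store → Prop}
    (h : Q (Store.put σ a (i.eval σ) (e.eval σ))) :
    Runs (.write a i e) σ (i.cost + e.cost + 1) Q :=
  ⟨_, _, .write a i e σ, le_rfl, h⟩

/-- A branch costs at most as much as both of its alternatives together. -/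
theorem Runs.cond {c : Expr} {p q : Prog} {σ : Store} {m m' : ℕ} {Q : Store → Prop}
    (hp : c.eval σ ≠ 0 → Runs p σ m Q) (hq : c.eval σ = 0 → Runs q σ m' Q) :
    Runs (.cond c p q) σ (c.cost + 1 + (m + m')) Q := by
  by_cases h : c.eval σ = 0
  · obtain ⟨τ, σ', h1, h2, h3⟩ := hq h
    exact ⟨_, _, .cond_false h h1, by omega, h3⟩
  · obtain ⟨τ, σ', h1, h2, h3⟩ := hp h
    exact ⟨_, _, .cond_true h h1, by omega, h3⟩

/-- The loop `for x in 0, …, N - 1 do p`, where `N` is the content of cell `w` of array `4`, and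
the counter is cell `0` of array `x`. -/
def Prog.forTo (x w : ℕ) (p : Prog) : Prog :=
  .seq (.write x (.const 0) (.const 0))
    (.loop (.sub (.read 4 (.const w)) (.read x (.const 0)))
      (.seq p (.write x (.const 0) (.add (.read x (.const 0)) (.const 1)))))

/-- The rule for counting loops: `I i` holds before round number `i`. -/
theorem Runs.forTo {x w : ℕ} {p : Prog} {σ : Store} {I : ℕ → Store → Prop} {N t : ℕ}
    (hI : ∀ i σ, I i σ → σ 4 w = N ∧ σ x 0 = i) (h0 : I 0 (Store.put σ x 0 0))
    (hs : ∀ i < N, ∀ σ, I i σ →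
      Runs p σ t (fun σ' => σ' x 0 = i ∧ I (i + 1) (Store.put σ' x 0 (i + 1)))) :
    Runs (.forTo x w p) σ (N * (t + 12) + 9) (I N) := by
  have key : ∀ d i σ, i + d = N → I i σ →
      Runs (.loop (.sub (.read 4 (.const w)) (.read x (.const 0)))
        (.seq p (.write x (.const 0) (.add (.read x (.const 0)) (.const 1))))) σ
        (d * (t + 12) + 6) (I N) := by
    intro d
    induction d with
    | zero =>
      intro i σ hi h
      obtain ⟨h1, h2⟩ := hI i σ h
      obtain rfl : i = N := by omega
      exact ⟨_, _, Exec.loop_stop (by simp [Expr.eval, h1, h2]), by simp [Expr.cost], h⟩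
    | succ d ih =>
      intro i σ hi h
      obtain ⟨h1, h2⟩ := hI i σ h
      obtain ⟨τ, σ', h3, h4, h5, h6⟩ := hs i (by omega) σ h
      obtain ⟨τ', σ'', h7, h8, h9⟩ := ih (i + 1) _ (by omega) h6
      refine ⟨_, _, .loop_step (by simp only [Expr.eval, h1, h2]; omega)
        (.seq h3 (.write x _ _ _)) (by simpa [Expr.eval, h5, Store.put] using h7), ?_, h9⟩
      simp only [Expr.cost]
      have : (d + 1) * (t + 12) = d * (t + 12) + (t + 12) := by ring
      omega
  refine (Runs.seq (Q := I 0) (.write (by simpa [Expr.eval] using h0))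
    (fun σ' h => key N 0 σ' (by omega) h)).mono ?_ (fun _ h => h)
  simp only [Expr.cost]
  omega

/-! ### Functions computable in polynomial time from data in memory -/

/-- Only arrays with number at least `u` and the cells of array `4` from `w` on have changed.
Array `4` is the stack of intermediate results. -/
structure Keep (u w : ℕ) (σ σ' : Store) : Prop where
  array : ∀ a < u, a ≠ 4 → σ' a = σ a
  stack : ∀ i < w, σ' 4 i = σ 4 i

theorem Keep.refl (u w : ℕ) (σ : Store) : Keep u w σ σ := ⟨fun _ _ _ => rfl, fun _ _ => rfl⟩

theorem Keep.trans {u w u' w' : ℕ} {σ σ' σ'' : Store} (h : Keep u w σ σ') (h' : Keep u' w' σ' σ'')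
    (hu : u ≤ u') (hw : w ≤ w') : Keep u w σ σ'' :=
  ⟨fun a ha h4 => (h'.array a (ha.trans_le hu) h4).trans (h.array a ha h4),
    fun i hi => (h'.stack i (hi.trans_le hw)).trans (h.stack i hi)⟩

theorem Keep.put_stack {u w : ℕ} {σ σ' : Store} (h : Keep u w σ σ') {i : ℕ} (x : ℕ)
    (hi : w ≤ i) : Keep u w σ (Store.put σ' 4 i x) :=
  ⟨fun a ha h4 => by rw [Store.put_array _ _ _ h4]; exact h.array a ha h4,
    fun j hj => by rw [Store.put_cell _ _ _ (by omega)]; exact h.stack j hj⟩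

theorem Keep.put_array {u w : ℕ} {σ σ' : Store} (h : Keep u w σ σ') {a : ℕ} (i x : ℕ)
    (ha : u ≤ a) (h4 : 4 < a) : Keep u w σ (Store.put σ' a i x) :=
  ⟨fun b hb hb4 => by rw [Store.put_array _ _ _ (by omega)]; exact h.array b hb hb4,
    fun j hj => by rw [Store.put_array _ _ _ (by omega)]; exact h.stack j hj⟩

/-- A way of holding the data `γ : Γ` in memory: `rep γ σ` says that the memory `σ` holds `γ`, in
the arrays with number less than `v` other than the stack. The first input cell must hold the
number `size γ`, in which running times are measured. -/
structure Ctx (Γ : Type) where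
  v : ℕ
  rep : Γ → Store → Prop
  size : Γ → ℕ
  lt_v : 4 < v
  size_eq : ∀ {γ σ}, rep γ σ → σ 0 0 = size γ
  stable : ∀ {γ σ σ'}, rep γ σ → (∀ a < v, a ≠ 4 → σ' a = σ a) → rep γ σ'

variable {Γ Γ' Γ'' : Type}

theorem Ctx.stable_keep (C : Ctx Γ) {γ : Γ} {σ σ' : Store} {u w : ℕ} (h : C.rep γ σ)
    (hk : Keep u w σ σ') (hu : C.v ≤ u) : C.rep γ σ' :=
  C.stable h fun a ha => hk.array a (ha.trans_le hu)

/-- The function `f` of the data is computable in polynomial time: whichever arrays `≥ u` and stack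
cells `≥ w` are free, some program uses only those and leaves the value in stack cell `w`. -/
def Comp (C : Ctx Γ) (f : Γ → ℕ) : Prop :=
  ∀ u, C.v ≤ u → ∀ w, ∃ (p : Prog) (T : Polynomial ℕ), ∀ γ σ, C.rep γ σ →
    Runs p σ (T.eval (C.size γ)) (fun σ' => Keep u w σ σ' ∧ σ' 4 w = f γ)

open Classical in
/-- The property `P` of the data is decidable in polynomial time. -/
def CompP (C : Ctx Γ) (P : Γ → Prop) : Prop :=
  Comp C (fun γ => if P γ then 1 else 0)

/-- Memories of `C'` hold the data of `C` as well, namely `f γ'` when they hold `γ'`. -/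
structure Extends (C' : Ctx Γ') (C : Ctx Γ) (f : Γ' → Γ) : Prop where
  v_le : C.v ≤ C'.v
  rep : ∀ {γ' σ}, C'.rep γ' σ → C.rep (f γ') σ

theorem Extends.refl (C : Ctx Γ) : Extends C C id := ⟨le_rfl, fun h => h⟩

theorem Extends.trans {C'' : Ctx Γ''} {C' : Ctx Γ'} {C : Ctx Γ} {g : Γ'' → Γ'} {f : Γ' → Γ}
    (h' : Extends C'' C' g) (h : Extends C' C f) : Extends C'' C (f ∘ g) :=
  ⟨h.v_le.trans h'.v_le, fun hr => h.rep (h'.rep hr)⟩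

theorem Comp.lift {C : Ctx Γ} {f : Γ → ℕ} (h : Comp C f) {C' : Ctx Γ'} {g : Γ' → Γ}
    (hg : Extends C' C g) : Comp C' (fun γ' => f (g γ')) := by
  intro u hu w
  obtain ⟨p, T, hp⟩ := h u (hg.v_le.trans hu) w
  refine ⟨p, T, fun γ' σ hr => ?_⟩
  have := hp _ _ (hg.rep hr)
  rwa [← C.size_eq (hg.rep hr), C'.size_eq hr] at this

theorem CompP.lift {C : Ctx Γ} {P : Γ → Prop} (h : CompP C P) {C' : Ctx Γ'} {g : Γ' → Γ}
    (hg : Extends C' C g) : CompP C' (fun γ' => P (g γ')) :=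
  Comp.lift h hg

theorem Comp.congr {C : Ctx Γ} {f g : Γ → ℕ} (h : Comp C f) (hfg : ∀ γ, g γ = f γ) : Comp C g := by
  rwa [funext hfg]

/-- It is enough that the two properties agree on data that some memory holds. -/
theorem CompP.congr_of_rep {C : Ctx Γ} {P Q : Γ → Prop} (h : CompP C P)
    (hPQ : ∀ γ σ, C.rep γ σ → (Q γ ↔ P γ)) : CompP C Q := by
  intro u hu w
  obtain ⟨p, T, hp⟩ := h u hu w
  refine ⟨p, T, fun γ σ hr => ?_⟩
  beta_reduce
  rw [propext (hPQ γ σ hr)]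
  exact hp γ σ hr

theorem CompP.congr {C : Ctx Γ} {P Q : Γ → Prop} (h : CompP C P) (hPQ : ∀ γ, Q γ ↔ P γ) :
    CompP C Q := by
  rwa [funext fun γ => propext (hPQ γ)]

theorem Comp.const (C : Ctx Γ) (c : ℕ) : Comp C (fun _ => c) := by
  intro u hu w
  refine ⟨.write 4 (.const w) (.const c), Polynomial.C 3, fun γ σ hr => ?_⟩
  rw [Polynomial.eval_C]
  exact .write ⟨(Keep.refl u w σ).put_stack _ le_rfl, by simp [Expr.eval]⟩

theorem Comp.op {C : Ctx Γ} {f g : Γ → ℕ} {op : Expr → Expr → Expr} {φ : ℕ → ℕ → ℕ}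
    (hop : ∀ e e' σ, (op e e').eval σ = φ (e.eval σ) (e'.eval σ)) (hf : Comp C f)
    (hg : Comp C g) : Comp C (fun γ => φ (f γ) (g γ)) := by
  intro u hu w
  obtain ⟨p, T, hp⟩ := hf u hu w
  obtain ⟨q, T', hq⟩ := hg u hu (w + 1)
  refine ⟨.seq p (.seq q (.write 4 (.const w) (op (.read 4 (.const w)) (.read 4 (.const (w + 1)))))),
    T + (T' + Polynomial.C (((Expr.const w).cost +
      (op (.read 4 (.const w)) (.read 4 (.const (w + 1)))).cost + 1))), fun γ σ hr => ?_⟩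
  simp only [Polynomial.eval_add, Polynomial.eval_C]
  refine .seq (hp γ σ hr) fun σ₁ ⟨k₁, e₁⟩ => ?_
  refine .seq (hq γ σ₁ (C.stable_keep hr k₁ hu)) fun σ₂ ⟨k₂, e₂⟩ => .write ⟨?_, ?_⟩
  · exact (k₁.trans k₂ le_rfl (by omega)).put_stack _ le_rfl
  · simp [Expr.eval, hop, e₂, k₂.stack w (by omega), e₁]

theorem Comp.add {C : Ctx Γ} {f g : Γ → ℕ} (hf : Comp C f) (hg : Comp C g) :
    Comp C (fun γ => f γ + g γ) :=
  Comp.op (op := .add) (fun _ _ _ => rfl) hf hg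

theorem Comp.sub {C : Ctx Γ} {f g : Γ → ℕ} (hf : Comp C f) (hg : Comp C g) :
    Comp C (fun γ => f γ - g γ) :=
  Comp.op (op := .sub) (φ := fun x y => x - y) (fun _ _ _ => rfl) hf hg

open Classical in
/-- Reading a cell whose content is determined by the data if `P` holds. -/
theorem Comp.read_if {C : Ctx Γ} {P : Γ → Prop} {e g : Γ → ℕ} (a : ℕ) (hP : CompP C P)
    (he : Comp C e)
    (h : ∀ γ σ, C.rep γ σ → P γ → σ a (e γ) = g γ) :
    Comp C (fun γ => if P γ then g γ else 0) := by
  intro u hu w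
  obtain ⟨p, T, hp⟩ := hP u hu w
  obtain ⟨q, T', hq⟩ := he u hu w
  refine ⟨.seq p (.cond (.read 4 (.const w))
    (.seq q (.write 4 (.const w) (.read a (.read 4 (.const w)))))
    (.write 4 (.const w) (.const 0))), T + (Polynomial.C 3 + (T' + Polynomial.C 5 + Polynomial.C 3)),
    fun γ σ hr => ?_⟩
  simp only [Polynomial.eval_add, Polynomial.eval_C]
  refine .seq (hp γ σ hr) fun σ₁ ⟨k₁, e₁⟩ => .cond (fun hc => ?_) (fun hc => .write ?_)
  · have hPγ : P γ := by
      by_contra hn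
      simp [Expr.eval, e₁, hn] at hc
    have hr₁ := C.stable_keep hr k₁ hu
    refine .seq (hq γ σ₁ hr₁) fun σ₂ ⟨k₂, e₂⟩ => .write ⟨?_, ?_⟩
    · exact (k₁.trans k₂ le_rfl le_rfl).put_stack _ le_rfl
    · simp [Expr.eval, e₂, hPγ, h γ σ₂ (C.stable_keep hr₁ k₂ hu) hPγ]
  · have hPγ : ¬ P γ := by
      intro hn
      simp [Expr.eval, e₁, hn] at hc
    exact ⟨k₁.put_stack _ le_rfl, by simp [Expr.eval, hPγ]⟩

theorem CompP.true (C : Ctx Γ) : CompP C (fun _ => True) :=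
  (Comp.const C 1).congr fun _ => by simp

theorem Comp.read {C : Ctx Γ} {e g : Γ → ℕ} (a : ℕ) (he : Comp C e)
    (h : ∀ γ σ, C.rep γ σ → σ a (e γ) = g γ) : Comp C g :=
  (Comp.read_if a (CompP.true C) he (fun γ σ hr _ => h γ σ hr)).congr fun _ => by simp

theorem Comp.size (C : Ctx Γ) : Comp C C.size :=
  Comp.read 0 (Comp.const C 0) fun _ _ => C.size_eq

theorem CompP.not {C : Ctx Γ} {P : Γ → Prop} (h : CompP C P) : CompP C (fun γ => ¬ P γ) :=
  (Comp.sub (Comp.const C 1) h).congr fun γ => by by_cases P γ <;> simp [*]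

theorem CompP.and {C : Ctx Γ} {P Q : Γ → Prop} (h : CompP C P) (h' : CompP C Q) :
    CompP C (fun γ => P γ ∧ Q γ) :=
  (Comp.sub (Comp.const C 1) (Comp.add h.not h'.not)).congr fun γ => by
    by_cases P γ <;> by_cases Q γ <;> simp [*]

theorem CompP.or {C : Ctx Γ} {P Q : Γ → Prop} (h : CompP C P) (h' : CompP C Q) :
    CompP C (fun γ => P γ ∨ Q γ) :=
  (h.not.and h'.not).not.congr fun γ => by tauto

theorem CompP.imp {C : Ctx Γ} {P Q : Γ → Prop} (h : CompP C P) (h' : CompP C Q) :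
    CompP C (fun γ => P γ → Q γ) :=
  (h.not.or h').congr fun γ => by tauto

theorem Comp.lt {C : Ctx Γ} {f g : Γ → ℕ} (hf : Comp C f) (hg : Comp C g) :
    CompP C (fun γ => f γ < g γ) :=
  (Comp.sub (Comp.const C 1) (Comp.sub (Comp.const C 1) (Comp.sub hg hf))).congr fun γ => by
    split_ifs <;> omega

theorem Comp.le {C : Ctx Γ} {f g : Γ → ℕ} (hf : Comp C f) (hg : Comp C g) :
    CompP C (fun γ => f γ ≤ g γ) :=
  (hg.lt hf).not.congr fun γ => by omega

theorem Comp.eq {C : Ctx Γ} {f g : Γ → ℕ} (hf : Comp C f) (hg : Comp C g) :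
    CompP C (fun γ => f γ = g γ) :=
  ((hf.le hg).and (hg.le hf)).congr fun γ => by omega

/-! ### Bounded quantifiers -/

/-- Number of rounds allowed in a loop: computable, and bounded by a polynomial in the size. -/
structure Bound (C : Ctx Γ) (N : Γ → ℕ) : Prop where
  comp : Comp C N
  le : ∃ P : Polynomial ℕ, ∀ γ σ, C.rep γ σ → N γ ≤ P.eval (C.size γ)

theorem Bound.lift {C : Ctx Γ} {N : Γ → ℕ} (h : Bound C N) {C' : Ctx Γ'} {g : Γ' → Γ}
    (hg : Extends C' C g) : Bound C' (fun γ' => N (g γ')) := by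
  obtain ⟨P, hP⟩ := h.le
  refine ⟨h.comp.lift hg, P, fun γ' σ hr => ?_⟩
  rw [← C'.size_eq hr, C.size_eq (hg.rep hr)]
  exact hP _ _ (hg.rep hr)

/-- Add a number below `N` to the data, stored in cell `0` of array `u`. -/
def Ctx.ext (C : Ctx Γ) (u : ℕ) (hu : C.v ≤ u) (N : Γ → ℕ) : Ctx (Σ γ, Fin (N γ)) where
  v := u + 1
  rep p σ := C.rep p.1 σ ∧ σ u 0 = p.2
  size p := C.size p.1
  lt_v := by have := C.lt_v; omega
  size_eq h := C.size_eq h.1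
  stable h hk := ⟨C.stable h.1 fun a ha => hk a (by omega), by
    rw [hk u (by omega) (by have := C.lt_v; omega)]; exact h.2⟩

theorem Ctx.extends_ext (C : Ctx Γ) (u : ℕ) (hu : C.v ≤ u) (N : Γ → ℕ) :
    Extends (C.ext u hu N) C Sigma.fst :=
  ⟨by simp only [Ctx.ext]; omega, fun h => h.1⟩

theorem Ctx.comp_ext (C : Ctx Γ) (u : ℕ) (hu : C.v ≤ u) (N : Γ → ℕ) :
    Comp (C.ext u hu N) (fun p => (p.2 : ℕ)) :=
  Comp.read u (Comp.const _ 0) fun _ _ h => h.2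

variable {N M : Γ → ℕ}

/-- The number `g γ i` is computable from `γ` and an index `i` that is itself computable, in every
context that extends the given one. The quantification over extensions is what lets `g` be used
below any number of binders. -/
def CompFun (C : Ctx Γ) (g : ∀ γ, Fin (N γ) → ℕ) : Prop :=
  ∀ ⦃Γ' : Type⦄ (C' : Ctx Γ') (f : Γ' → Γ), Extends C' C f → ∀ x : ∀ γ', Fin (N (f γ')),
    Comp C' (fun γ' => (x γ' : ℕ)) → Comp C' (fun γ' => g (f γ') (x γ'))

/-- The analogue of `CompFun` for predicates. -/
def CompPred (C : Ctx Γ) (P : ∀ γ, Fin (N γ) → Prop) : Prop :=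
  ∀ ⦃Γ' : Type⦄ (C' : Ctx Γ') (f : Γ' → Γ), Extends C' C f → ∀ x : ∀ γ', Fin (N (f γ')),
    Comp C' (fun γ' => (x γ' : ℕ)) → CompP C' (fun γ' => P (f γ') (x γ'))

/-- The analogue of `CompFun` for binary relations. -/
def CompRel (C : Ctx Γ) (E : ∀ γ, Fin (N γ) → Fin (M γ) → Prop) : Prop :=
  ∀ ⦃Γ' : Type⦄ (C' : Ctx Γ') (f : Γ' → Γ), Extends C' C f →
    ∀ (x : ∀ γ', Fin (N (f γ'))) (y : ∀ γ', Fin (M (f γ'))),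
    Comp C' (fun γ' => (x γ' : ℕ)) → Comp C' (fun γ' => (y γ' : ℕ)) →
      CompP C' (fun γ' => E (f γ') (x γ') (y γ'))

/-- Membership in the sets `S γ` is decidable in polynomial time. -/
abbrev CompSet (C : Ctx Γ) (S : ∀ γ, Finset (Fin (N γ))) : Prop :=
  CompPred C (fun γ x => x ∈ S γ)

theorem CompPred.lift {C : Ctx Γ} {P : ∀ γ, Fin (N γ) → Prop} (h : CompPred C P) {C' : Ctx Γ'}
    {g : Γ' → Γ} (hg : Extends C' C g) : CompPred C' (fun γ' => P (g γ')) :=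
  fun _ C'' f hf x hx => h C'' (g ∘ f) (hf.trans hg) x hx

theorem CompRel.lift {C : Ctx Γ} {E : ∀ γ, Fin (N γ) → Fin (M γ) → Prop} (h : CompRel C E)
    {C' : Ctx Γ'} {g : Γ' → Γ} (hg : Extends C' C g) : CompRel C' (fun γ' => E (g γ')) :=
  fun _ C'' f hf x y hx hy => h C'' (g ∘ f) (hf.trans hg) x y hx hy

theorem Comp.sum {C : Ctx Γ} {g : ∀ γ, Fin (N γ) → ℕ} (hN : Bound C N) (hg : CompFun C g) :
    Comp C (fun γ => ∑ i, g γ i) := by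
  intro u hu w
  have hv := C.lt_v
  obtain ⟨P, hP⟩ := hN.le
  obtain ⟨p, T, hp⟩ := hN.comp u hu w
  obtain ⟨q, T', hq⟩ := hg _ _ (C.extends_ext u hu N) (fun p => p.2) (C.comp_ext u hu N)
    (u + 1) le_rfl (w + 2)
  -- cells `w`, `w + 1`, `w + 2` of the stack: number of rounds, partial sum, current summand
  refine ⟨.seq p (.seq (.write 4 (.const (w + 1)) (.const 0)) (.seq (.forTo u w
    (.seq q (.write 4 (.const (w + 1))
      (.add (.read 4 (.const (w + 1))) (.read 4 (.const (w + 2)))))))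
    (.write 4 (.const w) (.read 4 (.const (w + 1)))))),
    T + (Polynomial.C 3 + (P * (T' + Polynomial.C 7 + Polynomial.C 12) + Polynomial.C 9
      + Polynomial.C 4)), fun γ σ hr => ?_⟩
  simp only [Polynomial.eval_add, Polynomial.eval_C, Polynomial.eval_mul]
  refine .seq (hp γ σ hr) fun σ₁ ⟨k₁, e₁⟩ => ?_
  refine .seq (Q := fun σ' => Keep u w σ σ' ∧ σ' 4 w = N γ ∧ σ' 4 (w + 1) = 0)
    (.write ⟨k₁.put_stack _ (by simp [Expr.eval]), ?_, by simp [Expr.eval]⟩)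
    fun σ₂ ⟨k₂, e₂, e₂'⟩ => ?_
  · rw [Store.put_cell _ _ _ (by simp [Expr.eval])]
    exact e₁
  refine .seq (Q := fun σ' => Keep u w σ σ' ∧ σ' 4 (w + 1) = ∑ i, g γ i) ?_
    fun σ₃ ⟨k₃, e₃⟩ => .write ⟨k₃.put_stack _ le_rfl, by simp [Expr.eval, e₃]⟩
  refine (Runs.forTo (N := N γ) (t := T'.eval (C.size γ) + 7) (I := fun i σ' => Keep u w σ σ' ∧
    σ' 4 w = N γ ∧ σ' u 0 = i ∧ σ' 4 (w + 1) = ∑ j : Fin (N γ), if j.val < i then g γ j else 0)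
    (fun i σ' h => ⟨h.2.1, h.2.2.1⟩) ?_ ?_).mono ?_ ?_
  · refine ⟨k₂.put_array _ _ le_rfl (by omega), ?_, by simp, ?_⟩
    · rw [Store.put_array _ _ _ (by omega), e₂]
    · rw [Store.put_array _ _ _ (by omega), e₂']
      simp
  · rintro i hi σ' ⟨k, e, eu, es⟩
    refine .seq (hq ⟨γ, i, hi⟩ σ' ⟨C.stable_keep hr k hu, eu⟩) fun σ'' ⟨k', e'⟩ =>
      Runs.write ?_
    have h4u : u ≠ 4 := by omega
    have hk : Keep u w σ σ'' := k.trans k' (by omega) (by omega)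
    refine ⟨?_, (hk.put_stack _ (by simp [Expr.eval])).put_array _ _ le_rfl (by omega),
      ?_, by simp, ?_⟩
    · rw [Store.put_array _ _ _ h4u, k'.array u (by omega) h4u, eu]
    · rw [Store.put_array _ _ _ h4u.symm, Store.put_cell _ _ _ (by simp [Expr.eval]),
        k'.stack w (by omega), e]
    · rw [Store.put_array _ _ _ h4u.symm]
      simp only [Expr.eval, Store.put_same, e', k'.stack (w + 1) (by omega), es]
      have : ∀ j : Fin (N γ), (if j.val < i + 1 then g γ j else 0) =
          (if j.val < i then g γ j else 0) + if j = ⟨i, hi⟩ then g γ j else 0 := by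
        intro j
        by_cases h : j = ⟨i, hi⟩
        · subst h; simp
        · have h' : j.val ≠ i := fun h' => h (Fin.ext h')
          have : j.val < i + 1 ↔ j.val < i := by omega
          simp [h, this]
      rw [Finset.sum_congr rfl fun j _ => this j]
      simp [Finset.sum_add_distrib]
  · exact Nat.add_le_add_right (Nat.mul_le_mul_right _ (hP γ σ hr)) _
  · rintro σ' ⟨k, -, -, e⟩
    exact ⟨k, by simpa using e⟩

theorem CompPred.exists {C : Ctx Γ} {P : ∀ γ, Fin (N γ) → Prop} (hN : Bound C N)
    (hP : CompPred C P) : CompP C (fun γ => ∃ i, P γ i) := by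
  classical
  refine ((Comp.const C 0).lt (Comp.sum (g := fun γ i => if P γ i then 1 else 0) hN ?_)).congr
    fun γ => ?_
  · intro Γ' C' f hf x hx
    exact hP C' f hf x hx
  · simp [Nat.pos_iff_ne_zero]

theorem CompPred.not {C : Ctx Γ} {P : ∀ γ, Fin (N γ) → Prop} (hP : CompPred C P) :
    CompPred C (fun γ i => ¬ P γ i) :=
  fun _ C' f hf x hx => (hP C' f hf x hx).not

theorem CompPred.forall {C : Ctx Γ} {P : ∀ γ, Fin (N γ) → Prop} (hN : Bound C N)
    (hP : CompPred C P) : CompP C (fun γ => ∀ i, P γ i) :=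
  (CompPred.exists hN hP.not).not.congr fun γ => by push Not; rfl

theorem CompSet.card {C : Ctx Γ} {S : ∀ γ, Finset (Fin (N γ))} (hN : Bound C N)
    (hS : CompSet C S) : Comp C (fun γ => (S γ).card) := by
  classical
  refine (Comp.sum (g := fun γ i => if i ∈ S γ then 1 else 0) hN ?_).congr fun γ => by simp
  intro Γ' C' f hf x hx
  have := hS C' f hf x hx
  unfold CompP at this
  convert this

theorem Comp.mul {C : Ctx Γ} {f : Γ → ℕ} (hf : Comp C f) (hN : Bound C N) :
    Comp C (fun γ => f γ * N γ) :=
  (Comp.sum (g := fun γ _ => f γ) hN fun _ _ _ hg _ _ => hf.lift hg).congr fun γ => by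
    simp [mul_comm]

theorem Bound.size (C : Ctx Γ) : Bound C C.size :=
  ⟨Comp.size C, Polynomial.X, fun _ _ _ => by simp⟩

theorem Bound.poly (C : Ctx Γ) (q : Polynomial ℕ) : Bound C (fun γ => q.eval (C.size γ)) := by
  refine ⟨?_, q, fun _ _ _ => le_rfl⟩
  induction q using Polynomial.induction_on with
  | C a => simpa using Comp.const C a
  | add p q hp hq => simpa using hp.add hq
  | monomial n a h => simpa [pow_succ, mul_assoc] using h.mul (Bound.size C)

/-! ### Course-of-values recursion over tables -/

/-- The table with rows `0, …, r - 1` in which row `m` is computed by `step m` from the table of the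
rows before it. Rows that do not exist yet are empty. -/
def rows {N : ℕ} (step : ℕ → (ℕ → Finset (Fin N)) → Finset (Fin N)) : ℕ → ℕ → Finset (Fin N)
  | 0 => fun _ => ∅
  | r + 1 => Function.update (rows step r) r (step r (rows step r))

theorem rows_of_le {N : ℕ} (step : ℕ → (ℕ → Finset (Fin N)) → Finset (Fin N)) {r m : ℕ}
    (h : r ≤ m) : rows step r m = ∅ := by
  induction r with
  | zero => rfl
  | succ r ih => rw [rows, Function.update_of_ne (by omega), ih (by omega)]

theorem rows_of_lt {N : ℕ} (step : ℕ → (ℕ → Finset (Fin N)) → Finset (Fin N)) {r m : ℕ}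
    (h : m < r) : rows step r m = step m (rows step m) := by
  induction r with
  | zero => omega
  | succ r ih =>
    rw [rows]
    by_cases hm : m = r
    · rw [hm, Function.update_self]
    · rw [Function.update_of_ne hm, ih (by omega)]

/-- Membership in the rows of the tables `R γ` is decidable in polynomial time. -/
def CompRows (C : Ctx Γ) (R : ∀ γ, ℕ → Finset (Fin (N γ))) : Prop :=
  ∀ ⦃Γ' : Type⦄ (C' : Ctx Γ') (f : Γ' → Γ), Extends C' C f →
    ∀ (m : Γ' → ℕ) (x : ∀ γ', Fin (N (f γ'))),
    Comp C' m → Comp C' (fun γ' => (x γ' : ℕ)) → CompP C' (fun γ' => x γ' ∈ R (f γ') (m γ'))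

theorem CompRows.lift {C : Ctx Γ} {R : ∀ γ, ℕ → Finset (Fin (N γ))} (h : CompRows C R)
    {C' : Ctx Γ'} {g : Γ' → Γ} (hg : Extends C' C g) : CompRows C' (fun γ' => R (g γ')) :=
  fun _ C'' f hf m x hm hx => h C'' (g ∘ f) (hf.trans hg) m x hm hx

theorem CompRows.row {C : Ctx Γ} {R : ∀ γ, ℕ → Finset (Fin (N γ))} (h : CompRows C R)
    {m : Γ → ℕ} (hm : Comp C m) : CompSet C (fun γ => R γ (m γ)) :=
  fun _ C' f hf x hx => h C' f hf (fun γ' => m (f γ')) x (hm.lift hf) hx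

open Classical in
/-- Add to the data a table `R` of `r` rows with `N` columns: `r` is stored in array `u`, and
entry `(m, x)` of the table in cell `m * N + x` of array `u + 1`. -/
def Ctx.extRows (C : Ctx Γ) (u : ℕ) (hu : C.v ≤ u) (N : Γ → ℕ) :
    Ctx (Σ γ, ℕ × (ℕ → Finset (Fin (N γ)))) where
  v := u + 2
  rep p σ := C.rep p.1 σ ∧ σ u 0 = p.2.1 ∧ (∀ m, p.2.1 ≤ m → p.2.2 m = ∅) ∧
    ∀ m < p.2.1, ∀ x : Fin (N p.1), σ (u + 1) (m * N p.1 + x) = if x ∈ p.2.2 m then 1 else 0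
  size p := C.size p.1
  lt_v := by have := C.lt_v; omega
  size_eq h := C.size_eq h.1
  stable h hk := by
    have := C.lt_v
    refine ⟨C.stable h.1 fun a ha => hk a (by omega), ?_⟩
    rw [hk u (by omega) (by omega), hk (u + 1) (by omega) (by omega)]
    exact h.2

theorem Ctx.extends_extRows (C : Ctx Γ) (u : ℕ) (hu : C.v ≤ u) (N : Γ → ℕ) :
    Extends (C.extRows u hu N) C Sigma.fst :=
  ⟨by simp only [Ctx.extRows]; omega, fun h => h.1⟩

theorem Ctx.comp_extRows (C : Ctx Γ) (u : ℕ) (hu : C.v ≤ u) (N : Γ → ℕ) :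
    Comp (C.extRows u hu N) (fun p => p.2.1) :=
  Comp.read u (Comp.const _ 0) fun _ _ h => h.2.1

theorem Ctx.compRows_extRows (C : Ctx Γ) (u : ℕ) (hu : C.v ≤ u) (hN : Bound C N) :
    CompRows (N := fun p => N p.1) (C.extRows u hu N) (fun p => p.2.2) := by
  classical
  intro Γ' C' f hf m x hm hx
  have hN' := hN.lift (hf.trans (C.extends_extRows u hu N))
  have hm' := hm.lt ((C.comp_extRows u hu N).lift hf)
  -- the cells behind the last row hold arbitrary numbers, so they must not be read
  have hr := Comp.read_if (u + 1) hm' ((hm.mul hN').add hx) (g := fun γ' =>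
    if x γ' ∈ (f γ').2.2 (m γ') then 1 else 0) fun γ' σ h hlt => (hf.rep h).2.2.2 _ hlt _
  refine CompP.congr_of_rep (P := fun γ' => m γ' < (f γ').2.1 ∧ x γ' ∈ (f γ').2.2 (m γ'))
    (hr.congr fun γ' => by split_ifs <;> simp_all) fun γ' σ h => ?_
  refine ⟨fun hx => ⟨?_, hx⟩, fun hx => hx.2⟩
  by_contra hlt
  have hempty := (hf.rep h).2.2.1 (m γ') (by omega)
  beta_reduce at hx
  simp [hempty] at hx

/-- The rule for course-of-values recursion. Whatever is decidable with the help of the finished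
table is decidable, provided that each row is decidable with the help of the previous rows. -/
theorem CompP.rows {C : Ctx Γ} (hN : Bound C N) (hM : Bound C M)
    {step : ∀ γ, ℕ → (ℕ → Finset (Fin (N γ))) → Finset (Fin (N γ))}
    (hstep : ∀ ⦃Γ' : Type⦄ (C' : Ctx Γ') (f : Γ' → Γ), Extends C' C f → ∀ (r : Γ' → ℕ)
      (R : ∀ γ', ℕ → Finset (Fin (N (f γ')))) (x : ∀ γ', Fin (N (f γ'))),
      Comp C' r → CompRows (N := fun γ' => N (f γ')) C' R → Comp C' (fun γ' => (x γ' : ℕ)) →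
      CompP C' (fun γ' => x γ' ∈ step (f γ') (r γ') (R γ')))
    {g : ∀ γ, (ℕ → Finset (Fin (N γ))) → Prop}
    (hg : ∀ ⦃Γ' : Type⦄ (C' : Ctx Γ') (f : Γ' → Γ), Extends C' C f → ∀
      R : ∀ γ', ℕ → Finset (Fin (N (f γ'))), CompRows (N := fun γ' => N (f γ')) C' R →
      CompP C' (fun γ' => g (f γ') (R γ'))) :
    CompP C (fun γ => g γ (rows (step γ) (M γ))) := by
  classical
  intro u hu w
  have hv := C.lt_v
  obtain ⟨PN, hPN⟩ := hN.le
  obtain ⟨PM, hPM⟩ := hM.le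
  obtain ⟨pN, TN, hpN⟩ := hN.comp u hu w
  obtain ⟨pM, TM, hpM⟩ := hM.comp u hu (w + 1)
  have hext := C.extends_extRows u hu N
  have hext' := (C.extRows u hu N).extends_ext (u + 2) le_rfl (fun p => N p.1)
  obtain ⟨q, T, hq⟩ := hstep _ _ (hext'.trans hext) (fun p => p.1.2.1) (fun p => p.1.2.2)
    (fun p => p.2) ((C.comp_extRows u hu N).lift hext')
    ((C.compRows_extRows u hu hN).lift hext') (Ctx.comp_ext _ _ _ _) (u + 3) le_rfl (w + 3)
  obtain ⟨q', T', hq'⟩ := hg _ _ hext _ (C.compRows_extRows u hu hN) (u + 2) le_rfl w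
  -- stack cells `w`, `w + 1`, `w + 2`, `w + 3`: columns, rows, current address, current entry
  refine ⟨.seq pN (.seq pM (.seq (.write 4 (.const (w + 2)) (.const 0)) (.seq
    (.forTo u (w + 1) (.forTo (u + 2) w (.seq q
      (.seq (.write (u + 1) (.read 4 (.const (w + 2))) (.read 4 (.const (w + 3))))
        (.write 4 (.const (w + 2)) (.add (.read 4 (.const (w + 2))) (.const 1)))))))
    q'))),
    TN + (TM + (Polynomial.C 3 +
      (PM * (PN * (T + (Polynomial.C 5 + Polynomial.C 6) + Polynomial.C 12) + Polynomial.C 9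
        + Polynomial.C 12) + Polynomial.C 9 + T'))), fun γ σ hr => ?_⟩
  simp only [Polynomial.eval_add, Polynomial.eval_C, Polynomial.eval_mul]
  refine .seq (hpN γ σ hr) fun σ₁ ⟨k₁, e₁⟩ => ?_
  refine .seq (hpM γ σ₁ (C.stable_keep hr k₁ hu)) fun σ₂ ⟨k₂, e₂⟩ => ?_
  have hN₂ : σ₂ 4 w = N γ := (k₂.stack w (by omega)).trans e₁
  refine .seq (Q := fun σ' => Keep u w σ σ' ∧ σ' 4 w = N γ ∧ σ' 4 (w + 1) = M γ ∧
      σ' 4 (w + 2) = 0)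
    (.write ⟨(k₁.trans k₂ le_rfl (by omega)).put_stack _ (by simp [Expr.eval]), ?_, ?_,
      by simp [Expr.eval]⟩)
    fun σ₃ ⟨k₃, eN₃, eM₃, ea₃⟩ => ?_
  · rwa [Store.put_cell _ _ _ (by simp [Expr.eval])]
  · rwa [Store.put_cell _ _ _ (by simp [Expr.eval])]
  set R := SepReconf.rows (step γ) with hR
  -- before row `r`, and before entry `j` of that row
  let I : ℕ → Store → Prop := fun r σ' => Keep u w σ σ' ∧ σ' 4 w = N γ ∧ σ' 4 (w + 1) = M γ ∧
    σ' 4 (w + 2) = r * N γ ∧ σ' u 0 = r ∧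
    ∀ m < r, ∀ x : Fin (N γ), σ' (u + 1) (m * N γ + x) = if x ∈ R r m then 1 else 0
  let J : ℕ → ℕ → Store → Prop := fun r j σ' => Keep u w σ σ' ∧ σ' 4 w = N γ ∧
    σ' 4 (w + 1) = M γ ∧ σ' 4 (w + 2) = r * N γ + j ∧ σ' u 0 = r ∧ σ' (u + 2) 0 = j ∧
    (∀ m < r, ∀ x : Fin (N γ), σ' (u + 1) (m * N γ + x) = if x ∈ R r m then 1 else 0) ∧
    ∀ x : Fin (N γ), x.val < j → σ' (u + 1) (r * N γ + x) = if x ∈ step γ r (R r) then 1 else 0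
  refine .seq (Q := I (M γ)) ?_ fun σ₄ ⟨k₄, _, _, _, er₄, et₄⟩ => ?_
  swap
  · refine (hq' ⟨γ, M γ, R (M γ)⟩ σ₄ ⟨C.stable_keep hr k₄ hu, er₄,
      fun m hm => rows_of_le _ hm, et₄⟩).mono le_rfl fun σ₅ ⟨k₅, e₅⟩ =>
      ⟨k₄.trans k₅ (by omega) le_rfl, e₅⟩
  refine (Runs.forTo (I := I) (N := M γ)
    (t := PN.eval (C.size γ) * (T.eval (C.size γ) + (5 + 6) + 12) + 9)
    (fun i σ' h => ⟨h.2.2.1, h.2.2.2.2.1⟩) ?_ ?_).mono ?_ fun _ h => h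
  · refine ⟨k₃.put_array _ _ le_rfl (by omega), ?_, ?_, ?_, by simp, by simp⟩
    all_goals rw [Store.put_array _ _ _ (by omega)]
    · exact eN₃
    · exact eM₃
    · simpa using ea₃
  · rintro r hrM σ₄ ⟨k₄, eN₄, eM₄, ea₄, er₄, et₄⟩
    refine (Runs.forTo (I := J r) (N := N γ) (t := T.eval (C.size γ) + (5 + 6))
      (fun i σ' h => ⟨h.2.1, h.2.2.2.2.2.1⟩) ?_ ?_).mono ?_ ?_
    · refine ⟨k₄.put_array _ _ (by omega) (by omega), ?_, ?_, ?_, ?_, by simp, ?_, by simp⟩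
      all_goals rw [Store.put_array _ _ _ (by omega)]
      all_goals assumption
    · rintro j hj σ₅ ⟨k₅, eN₅, eM₅, ea₅, er₅, ej₅, et₅, et₅'⟩
      refine .seq (hq ⟨⟨γ, r, R r⟩, j, hj⟩ σ₅ ⟨⟨C.stable_keep hr k₅ hu, er₅,
        fun m hm => rows_of_le _ hm, et₅⟩, ej₅⟩) fun σ₆ ⟨k₆, e₆⟩ => ?_
      have k₇ : Keep u w σ σ₆ := k₅.trans k₆ (by omega) (by omega)
      have eN₆ : σ₆ 4 w = N γ := by rw [k₆.stack _ (by omega), eN₅]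
      have eM₆ : σ₆ 4 (w + 1) = M γ := by rw [k₆.stack _ (by omega), eM₅]
      have ea₆ : σ₆ 4 (w + 2) = r * N γ + j := by rw [k₆.stack _ (by omega), ea₅]
      have er₆ : σ₆ u 0 = r := by rw [k₆.array _ (by omega) (by omega), er₅]
      have ej₆ : σ₆ (u + 2) 0 = j := by rw [k₆.array _ (by omega) (by omega), ej₅]
      have et₆ : σ₆ (u + 1) = σ₅ (u + 1) := k₆.array _ (by omega) (by omega)
      rw [← et₆] at et₅ et₅'
      clear k₅ eN₅ eM₅ ea₅ er₅ ej₅ et₆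
      have e₇ : σ₆ 4 (w + 3) =
        if (⟨j, hj⟩ : Fin (N γ)) ∈ step γ r (R r) then 1 else 0 := by
        refine e₆.trans ?_
        dsimp only [Function.comp]
        congr
      refine .seq (.write (Q := fun σ' => σ' = Store.put σ₆ (u + 1) (r * N γ + j)
        (if (⟨j, hj⟩ : Fin (N γ)) ∈ step γ r (R r) then 1 else 0)) ?_) ?_
      · simp only [Expr.eval, ea₆, e₇]
      rintro _ rfl
      refine .write ⟨?_, ((k₇.put_array _ _ (by omega) (by omega)).put_stack _
        (by simp [Expr.eval])).put_array _ _ (by omega) (by omega), ?_, ?_, ?_, ?_, by simp, ?_, ?_⟩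
      · rwa [Store.put_array _ _ _ (by omega), Store.put_array _ _ _ (by omega)]
      · rwa [Store.put_array _ _ _ (by omega), Store.put_cell _ _ _ (by simp [Expr.eval]),
          Store.put_array _ _ _ (by omega)]
      · rwa [Store.put_array _ _ _ (by omega), Store.put_cell _ _ _ (by simp [Expr.eval]),
          Store.put_array _ _ _ (by omega)]
      · rw [Store.put_array _ _ _ (by omega)]
        simp only [Expr.eval, Store.put_same]
        rw [Store.put_array _ _ _ (by omega), ea₆, add_assoc]
      · rwa [Store.put_array _ _ _ (by omega), Store.put_array _ _ _ (by omega),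
          Store.put_array _ _ _ (by omega)]
      · intro m hm x
        -- row `m` ends before row `r` begins
        have : (m + 1) * N γ ≤ r * N γ := Nat.mul_le_mul_right _ hm
        have hx := x.isLt
        rw [Store.put_array _ _ _ (by omega), Store.put_array _ _ _ (by omega),
          Store.put_cell _ _ _ (by rw [add_mul] at this; omega)]
        exact et₅ m hm x
      · intro x hx
        rw [Store.put_array _ _ _ (by omega), Store.put_array _ _ _ (by omega)]
        by_cases hxj : x.val = j
        · obtain rfl : x = ⟨j, hj⟩ := Fin.ext hxj
          simp
        · rw [Store.put_cell _ _ _ (by omega)]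
          exact et₅' x (by omega)
    · exact Nat.add_le_add_right (Nat.mul_le_mul_right _ (hPN γ σ hr)) _
    · rintro σ₅ ⟨k₅, eN₅, eM₅, ea₅, er₅, ej₅, et₅, et₅'⟩
      refine ⟨er₅, k₅.put_array _ _ le_rfl (by omega), ?_, ?_, ?_, by simp, ?_⟩
      · rwa [Store.put_array _ _ _ (by omega)]
      · rwa [Store.put_array _ _ _ (by omega)]
      · rw [Store.put_array _ _ _ (by omega), ea₅]
        ring
      · intro m hm x
        rw [Store.put_array _ _ _ (by omega), hR, SepReconf.rows]
        by_cases hmr : m = r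
        · subst hmr
          rw [et₅' x x.isLt, Function.update_self]
        · rw [et₅ m (by omega) x, Function.update_of_ne hmr]
  · exact Nat.add_le_add_right (Nat.mul_le_mul_right _ (hPM γ σ hr)) _

/-! ### Reachability -/

open Classical in
/-- Row `r` consists of the elements that are reached from `a` in at most `r` steps. The empty row
stands in for row `0 - 1`. -/
noncomputable def reachStep {N : ℕ} (E : Fin N → Fin N → Prop) (a : Fin N) (r : ℕ)
    (R : ℕ → Finset (Fin N)) : Finset (Fin N) :=
  Finset.univ.filter fun x => x = a ∨ ∃ y, y ∈ R (r - 1) ∧ (y = x ∨ E y x)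

theorem mem_rows_reachStep {N : ℕ} (E : Fin N → Fin N → Prop) (a x : Fin N) :
    x ∈ rows (reachStep E a) (N + 1) N ↔ Relation.ReflTransGen E a x := by
  set F : ℕ → Finset (Fin N) := fun r => rows (reachStep E a) (r + 1) r with hF
  have h0 : ∀ x, x ∈ F 0 ↔ x = a := by
    intro x
    simp [hF, rows, reachStep]
  have hs : ∀ r x, x ∈ F (r + 1) ↔ ∃ y ∈ F r, y = x ∨ E y x := by
    have hmono : ∀ r, a ∈ F r := by
      intro r
      simp only [hF]
      rw [rows_of_lt _ (Nat.lt_succ_self r)]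
      simp [reachStep]
    intro r x
    simp only [hF]
    rw [rows_of_lt _ (Nat.lt_succ_self (r + 1))]
    simp only [reachStep, Finset.mem_filter, Finset.mem_univ, true_and, Nat.add_sub_cancel]
    refine ⟨?_, fun h => .inr h⟩
    rintro (rfl | h)
    · exact ⟨x, hmono r, .inl rfl⟩
    · exact h
  have hmono : Monotone F := monotone_nat_of_le_succ fun r x hx => (hs r x).2 ⟨x, hx, .inl rfl⟩
  have hstab : ∀ r, F r = F (r + 1) → F (r + 1) = F (r + 2) := by
    intro r h
    ext x
    rw [hs r, hs (r + 1), ← h]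
  -- the sets grow until they are stable, so they are stable after `N` steps
  have hN : F N = F (N + 1) := by
    have h1 := Nat.stabilises_of_monotone (f := fun r => (F r).card) (b := N) (n := N + 1)
      (fun _ _ h => Finset.card_le_card (hmono h))
      (fun r => (Finset.card_le_univ _).trans (by simp))
      (fun r h => by
        rw [← hstab r (Finset.eq_of_subset_of_card_le (hmono (Nat.le_succ r)) h.ge)])
      (Nat.le_succ N)
    exact Finset.eq_of_subset_of_card_le (hmono (Nat.le_succ N)) h1.le
  change x ∈ F N ↔ _
  constructor
  · have : ∀ r x, x ∈ F r → Relation.ReflTransGen E a x := by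
      intro r
      induction r with
      | zero => intro x hx; rw [(h0 x).1 hx]
      | succ r ih =>
        intro x hx
        obtain ⟨y, hy, rfl | h⟩ := (hs r x).1 hx
        · exact ih _ hy
        · exact (ih _ hy).tail h
    exact this N x
  · intro h
    induction h with
    | refl => exact hmono (Nat.zero_le N) ((h0 a).2 rfl)
    | tail _ h ih =>
      rw [hN]
      exact (hs N _).2 ⟨_, ih, .inr h⟩

theorem CompRel.reflTransGen {C : Ctx Γ} {E : ∀ γ, Fin (N γ) → Fin (N γ) → Prop} (hN : Bound C N)
    (hE : CompRel C E) {a b : ∀ γ, Fin (N γ)} (ha : Comp C (fun γ => (a γ : ℕ)))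
    (hb : Comp C (fun γ => (b γ : ℕ))) :
    CompP C (fun γ => Relation.ReflTransGen (E γ) (a γ) (b γ)) := by
  have hM : Bound C (fun γ => N γ + 1) := by
    obtain ⟨P, hP⟩ := hN.le
    exact ⟨hN.comp.add (Comp.const C 1), P + 1, fun γ σ hr => by simpa using hP γ σ hr⟩
  refine (CompP.rows hN hM (step := fun γ => reachStep (E γ) (a γ)) ?_
    (g := fun γ R => b γ ∈ R (N γ)) ?_).congr fun γ => (mem_rows_reachStep _ _ _).symm
  · intro Γ' C' f hf r R x hr hR hx
    refine ((hx.eq (ha.lift hf)).or (CompPred.exists (hN.lift hf) fun Γ'' C'' f' hf' y hy => ?_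
      )).congr (Q := _) (P := fun γ' => (x γ' : ℕ) = a (f γ') ∨
        ∃ y, y ∈ R γ' (r γ' - 1) ∧ ((y : ℕ) = x γ' ∨ E (f γ') y (x γ'))) fun γ' => ?_
    · exact (hR C'' f' hf' _ y ((hr.sub (Comp.const _ 1)).lift hf') hy).and
        ((hy.eq (hx.lift hf')).or (hE C'' _ (hf'.trans hf) y _ hy (hx.lift hf')))
    · simp [reachStep, Fin.ext_iff]
  · intro Γ' C' f hf R hR
    exact hR C' id (Extends.refl C') _ _ (hN.comp.lift hf) (hb.lift hf)

end Calculus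

/-! ### Separators and avoiding walks -/

section Separators

variable {V : Type*} {G : SimpleGraph V} {s t : V} {S T : Finset V}

/-- Some walk from `a` to `b` avoids `X`, except that `a` itself may be in `X`. -/
def Conn (G : SimpleGraph V) (X : Finset V) (a b : V) : Prop :=
  Relation.ReflTransGen (fun i j => G.Adj i j ∧ j ∉ X) a b

theorem Conn.notMem {X : Finset V} {a b : V} (h : Conn G X a b) (ha : a ∉ X) : b ∉ X := by
  induction h with
  | refl => exact ha
  | tail _ h _ => exact h.2

theorem Conn.symm {X : Finset V} {a b : V} (h : Conn G X a b) (ha : a ∉ X) : Conn G X b a := by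
  induction h with
  | refl => exact .refl
  | tail h h' ih => exact .head ⟨h'.1.symm, Conn.notMem h ha⟩ ih

theorem Conn.mono {X Y : Finset V} {a b : V} (h : Conn G X a b) (hY : Y ⊆ X) : Conn G Y a b :=
  Relation.ReflTransGen.mono (fun _ _ h => ⟨h.1, fun hy => h.2 (hY hy)⟩) _ _ h

theorem isSeparator_iff : IsSeparator G s t S ↔ s ∉ S ∧ t ∉ S ∧ ¬ Conn G S s t := by
  have key : ∀ (hs : s ∉ S) (ht : t ∉ S),
      (G.induce {v | v ∉ S}).Reachable ⟨s, hs⟩ ⟨t, ht⟩ ↔ Conn G S s t := by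
    intro hs ht
    rw [SimpleGraph.reachable_iff_reflTransGen]
    constructor
    · exact fun h => Relation.ReflTransGen.lift Subtype.val (fun a b hab => ⟨hab, b.2⟩) _ _ h
    · intro h
      have : ∀ v (hv : v ∉ S), Conn G S s v → Relation.ReflTransGen
          (G.induce {v | v ∉ S}).Adj ⟨s, hs⟩ ⟨v, hv⟩ := by
        intro v hv h
        induction h with
        | refl => exact .refl
        | tail h h' ih => exact (ih (Conn.notMem h hs)).tail h'.1
      exact this t ht h
  constructor
  · rintro ⟨hs, ht, h⟩
    exact ⟨hs, ht, fun h' => h ((key hs ht).2 h')⟩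
  · rintro ⟨hs, ht, h⟩
    exact ⟨hs, ht, fun h' => h ((key hs ht).1 h')⟩

theorem IsSeparator.mono (h : IsSeparator G s t S) (hST : S ⊆ T) (hs : s ∉ T) (ht : t ∉ T) :
    IsSeparator G s t T :=
  isSeparator_iff.2 ⟨hs, ht, fun h' => (isSeparator_iff.1 h).2.2 (h'.mono hST)⟩

theorem IsSeparator.notMem_left (h : IsSeparator G s t S) : s ∉ S := (isSeparator_iff.1 h).1

theorem IsSeparator.notMem_right (h : IsSeparator G s t S) : t ∉ S := (isSeparator_iff.1 h).2.1

theorem IsSeparator.exists_isMinSeparator (h : IsSeparator G s t S) :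
    ∃ S', S' ⊆ S ∧ IsMinSeparator G s t S' :=
  exists_minimal_le_of_wellFoundedLT _ S h

theorem IsMinSeparator.eq (h : IsMinSeparator G s t S) (hT : IsSeparator G s t T) (hTS : T ⊆ S) :
    T = S :=
  Finset.Subset.antisymm hTS (h.2 hT hTS)

end Separators

/-! ### The criterion for token addition and removal -/

section Criterion

variable {V : Type*} [DecidableEq V] {G : SimpleGraph V} {s t : V} {S T A B : Finset V} {k : ℕ}

theorem IsSeparator.union (h : IsSeparator G s t S) (h' : IsSeparator G s t T) :
    IsSeparator G s t (S ∪ T) :=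
  h.mono Finset.subset_union_left
    (by simp [h.notMem_left, h'.notMem_left]) (by simp [h.notMem_right, h'.notMem_right])

theorem TARStep.symm (h : TARStep k S T) : TARStep k T S :=
  ⟨by rw [symmDiff_comm]; exact h.1, by rw [max_comm]; exact h.2⟩

theorem TARStep.card_union_le (h : TARStep k S T) : (S ∪ T).card ≤ k := by
  obtain ⟨h1, h2⟩ := h
  have hcard : (symmDiff S T).card = (S \ T).card + (T \ S).card := by
    rw [symmDiff_def, Finset.sup_eq_union, Finset.card_union_of_disjoint disjoint_sdiff_sdiff]
  have h3 := Finset.card_union_add_card_inter S T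
  have h4 := Finset.card_sdiff_add_card_inter S T
  have h5 := Finset.card_sdiff_add_card_inter T S
  rw [Finset.inter_comm T S] at h5
  have h6 := le_max_left S.card T.card
  have h7 := le_max_right S.card T.card
  omega

theorem TAR.symm (h : TAR G s t S T k) : TAR G s t T S k :=
  (@Relation.ReflTransGen.stdSymm _ _
    ⟨fun _ _ h => ⟨h.2.1, h.1, TARStep.symm h.2.2⟩⟩).symm _ _ h

/-- Tokens are added one after another. -/
theorem TAR.of_subset (hS : IsSeparator G s t S) (hT : IsSeparator G s t T) (hST : S ⊆ T)
    (hk : T.card ≤ k) : TAR G s t S T k := by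
  induction h : (T \ S).card generalizing T with
  | zero =>
    have : T ⊆ S := Finset.sdiff_eq_empty_iff_subset.1 (Finset.card_eq_zero.1 h)
    rw [Finset.Subset.antisymm hST this]
    exact .refl
  | succ n ih =>
    obtain ⟨x, hx⟩ : (T \ S).Nonempty := Finset.card_pos.1 (by omega)
    obtain ⟨hxT, hxS⟩ := Finset.mem_sdiff.1 hx
    have hsub : S ⊆ T.erase x := fun y hy =>
      Finset.mem_erase.2 ⟨fun h => hxS (h ▸ hy), hST hy⟩
    have hsep : IsSeparator G s t (T.erase x) := hS.mono hsub
      (fun h => hT.notMem_left (Finset.mem_of_mem_erase h))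
      (fun h => hT.notMem_right (Finset.mem_of_mem_erase h))
    have hcard := Finset.card_erase_of_mem hxT
    refine (ih hsep hsub (by omega) ?_).tail ⟨hsep, hT, ?_, ?_⟩
    · rw [Finset.erase_sdiff_comm, Finset.card_erase_of_mem hx, h]
      rfl
    · have : symmDiff (T.erase x) T = {x} := by
        ext y
        by_cases hy : y = x
        · simp [Finset.mem_symmDiff, hy, hxT]
        · simp [Finset.mem_symmDiff, hy]
      rw [this, Finset.card_singleton]
    · exact max_le (by omega) hk

theorem TAR.of_card_union_le (hS : IsSeparator G s t S) (hT : IsSeparator G s t T)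
    (hk : (S ∪ T).card ≤ k) : TAR G s t S T k :=
  (TAR.of_subset hS (hS.union hT) Finset.subset_union_left hk).trans
    (TAR.of_subset hT (hS.union hT) Finset.subset_union_right hk).symm

theorem overlapGraph_reachable_of_card_union_le {A' B' : {S // IsMinSeparator G s t S}}
    (h : (A'.1 ∪ B'.1).card ≤ k) : (overlapGraph G s t k).Reachable A' B' := by
  by_cases hAB : A' = B'
  · rw [hAB]
  · exact SimpleGraph.Adj.reachable ⟨hAB, h⟩

/-- Minimal separators contained in the two states of a step overlap within `k`, so a sequence of
steps is followed by a walk of minimal separators, one in each state. Conversely, neighbours in the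
overlap graph are joined through their union. -/
theorem TAR_iff_reachable (hA : IsSeparator G s t A) (hB : IsSeparator G s t B)
    (hAk : A.card ≤ k) (hBk : B.card ≤ k) (A' B' : {S // IsMinSeparator G s t S})
    (hA' : A'.1 ⊆ A) (hB' : B'.1 ⊆ B) :
    TAR G s t A B k ↔ (overlapGraph G s t k).Reachable A' B' := by
  constructor
  · intro h
    clear hB hBk
    unfold TAR Reconfigurable at h
    induction h generalizing B' with
    | refl =>
      exact overlapGraph_reachable_of_card_union_le
        ((Finset.card_le_card (Finset.union_subset hA' hB')).trans hAk)
    | tail _ h ih =>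
      obtain ⟨C', hC', hmin⟩ := h.1.exists_isMinSeparator
      exact (ih ⟨C', hmin⟩ hC').trans (overlapGraph_reachable_of_card_union_le
        ((Finset.card_le_card (Finset.union_subset_union hC' hB')).trans h.2.2.card_union_le))
  · intro h
    have h' : TAR G s t A'.1 B'.1 k := by
      clear hB hBk hB'
      rw [SimpleGraph.reachable_iff_reflTransGen] at h
      induction h with
      | refl => exact .refl
      | @tail C' D' _ h ih => exact ih.trans (TAR.of_card_union_le C'.2.1 D'.2.1 h.2)
    exact ((TAR.of_subset A'.2.1 hA hA' hAk).symm.trans h').trans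
      (TAR.of_subset B'.2.1 hB hB' hBk)

/-- If a state is too large, then nothing can move. -/
theorem TAR_iff_eq (h : ¬ (A.card ≤ k ∧ B.card ≤ k)) : TAR G s t A B k ↔ A = B := by
  constructor
  · intro hT
    have hstep : ∀ {S T : Finset V}, TARStep k S T → S.card ≤ k ∧ T.card ≤ k := fun h =>
      ⟨(le_max_left _ _).trans h.2, (le_max_right _ _).trans h.2⟩
    rcases Relation.ReflTransGen.cases_head hT with rfl | ⟨C, hC, _⟩
    · rfl
    rcases Relation.ReflTransGen.cases_tail hT with rfl | ⟨D, _, hD⟩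
    · rfl
    exact absurd ⟨(hstep hC.2.2).1, (hstep hD.2.2).2⟩ h
  · rintro rfl
    exact .refl

/-! ### Token jumping reduces to token addition and removal -/

theorem TJ.card_eq (h : TJ G s t S T) : S.card = T.card := by
  unfold TJ Reconfigurable at h
  induction h with
  | refl => rfl
  | tail _ h ih => exact ih.trans h.2.2.1

/-- Two separators of the same size containing a common separator: the tokens outside it jump one
after another. -/
theorem TJ.of_common_subset {C : Finset V} (hC : IsSeparator G s t C) (hS : IsSeparator G s t S)
    (hT : IsSeparator G s t T) (hCS : C ⊆ S) (hCT : C ⊆ T) (hST : S.card = T.card) :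
    TJ G s t S T := by
  induction h : (T \ S).card generalizing T with
  | zero =>
    have : T ⊆ S := Finset.sdiff_eq_empty_iff_subset.1 (Finset.card_eq_zero.1 h)
    rw [Finset.eq_of_subset_of_card_le this hST.le]
    exact .refl
  | succ n ih =>
    obtain ⟨x, hx⟩ : (T \ S).Nonempty := Finset.card_pos.1 (by omega)
    have hST' := Finset.card_sdiff_comm hST
    obtain ⟨y, hy⟩ : (S \ T).Nonempty := Finset.card_pos.1 (by omega)
    obtain ⟨hxT, hxS⟩ := Finset.mem_sdiff.1 hx
    obtain ⟨hyS, hyT⟩ := Finset.mem_sdiff.1 hy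
    have hxy : x ≠ y := fun h => hxS (h ▸ hyS)
    set T' := insert y (T.erase x) with hT'
    have hyT' : y ∉ T.erase x := fun h => hyT (Finset.mem_of_mem_erase h)
    have hcard : T'.card = T.card := by
      rw [hT', Finset.card_insert_of_notMem hyT', Finset.card_erase_add_one hxT]
    have hsub : C ⊆ T' := fun z hz => Finset.mem_insert_of_mem
      (Finset.mem_erase.2 ⟨fun h => hxS (h ▸ hCS hz), hCT hz⟩)
    have hmem : ∀ z, z ∈ T' → z ∈ S ∨ z ∈ T := by
      intro z hz
      rcases Finset.mem_insert.1 hz with rfl | hz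
      · exact .inl hyS
      · exact .inr (Finset.mem_of_mem_erase hz)
    have hsep : IsSeparator G s t T' := hC.mono hsub
      (fun h => (hmem _ h).elim hS.notMem_left hT.notMem_left)
      (fun h => (hmem _ h).elim hS.notMem_right hT.notMem_right)
    have hd : T' \ S = (T \ S).erase x := by
      ext z
      by_cases hzy : z = y
      · subst hzy
        simp [hyS]
      · simp only [hT', Finset.mem_sdiff, Finset.mem_insert, Finset.mem_erase, hzy, false_or]
        tauto
    have h1 : T' \ T = {y} := by
      ext z
      by_cases hzy : z = y
      · subst hzy
        simp [hT', hyT]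
      · simp only [hT', Finset.mem_sdiff, Finset.mem_insert, Finset.mem_erase, hzy, false_or,
          Finset.mem_singleton]
        tauto
    have h2 : T \ T' = {x} := by
      ext z
      by_cases hzx : z = x
      · subst hzx
        simp [hT', hxT, hxy]
      · simp only [hT', Finset.mem_sdiff, Finset.mem_insert, Finset.mem_erase,
          Finset.mem_singleton]
        tauto
    refine (ih hsep hsub (hST.trans hcard.symm) ?_).tail ⟨hsep, hT, hcard, ?_, ?_⟩
    · rw [hd, Finset.card_erase_of_mem hx, h]
      rfl
    · rw [h1, Finset.card_singleton]
    · rw [h2, Finset.card_singleton]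

theorem TAR.of_TJ (h : TJ G s t A B) : TAR G s t A B (A.card + 1) := by
  have : ∀ {B}, TJ G s t A B → TAR G s t A B (A.card + 1) := by
    intro B h
    unfold TJ Reconfigurable at h
    induction h with
    | refl => exact .refl
    | tail h0 h ih =>
      refine ih.trans (TAR.of_card_union_le h.1 h.2.1 ?_)
      rw [Finset.union_comm, ← Finset.card_sdiff_add_card, h.2.2.2.2, TJ.card_eq h0, add_comm]
  exact this h

/-- Let `A ⊇ A'`, and walk in the overlap graph from `A'` to some `B'`. While the walk is followed,
tokens are kept on the current minimal separator, and the other tokens are wherever they are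
needed. A union of `|A| + 1` vertices is crossed by one jump. -/
theorem TJ.of_reachable (hA : IsSeparator G s t A) {A' B' : {S // IsMinSeparator G s t S}}
    (hA' : A'.1 ⊆ A) (h : (overlapGraph G s t (A.card + 1)).Reachable A' B') :
    ∃ X, IsSeparator G s t X ∧ X.card = A.card ∧ B'.1 ⊆ X ∧ TJ G s t A X := by
  rw [SimpleGraph.reachable_iff_reflTransGen] at h
  induction h with
  | refl => exact ⟨A, hA, rfl, hA', .refl⟩
  | @tail C' D' _ h ih =>
    obtain ⟨X, hX, hXc, hCX, hAX⟩ := ih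
    obtain ⟨hne, hcard⟩ := h
    have hU : IsSeparator G s t (C'.1 ∪ D'.1) := C'.2.1.union D'.2.1
    have hCD : ¬ C'.1 ⊆ D'.1 := fun h => hne (Subtype.ext (D'.2.eq C'.2.1 h))
    have hDC : ¬ D'.1 ⊆ C'.1 := fun h => hne (Subtype.ext (C'.2.eq D'.2.1 h).symm)
    by_cases hle : (C'.1 ∪ D'.1).card ≤ A.card
    · -- the union fits into a state
      have hXU := hU.union hX
      obtain ⟨Y, hUY, hYX, hYc⟩ := Finset.exists_subsuperset_card_eq
        (Finset.subset_union_left (s₁ := C'.1 ∪ D'.1) (s₂ := X)) hle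
        (by rw [← hXc]; exact Finset.card_le_card Finset.subset_union_right)
      have hY : IsSeparator G s t Y := hU.mono hUY (fun h => hXU.notMem_left (hYX h))
        (fun h => hXU.notMem_right (hYX h))
      exact ⟨Y, hY, hYc, Finset.subset_union_right.trans hUY, hAX.trans
        (TJ.of_common_subset C'.2.1 hX hY hCX (Finset.subset_union_left.trans hUY)
          (hXc.trans hYc.symm))⟩
    · -- leave out one vertex of the union on either side
      obtain ⟨c, hcC, hcD⟩ := Finset.not_subset.1 hCD
      obtain ⟨d, hdD, hdC⟩ := Finset.not_subset.1 hDC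
      have hcU : c ∈ C'.1 ∪ D'.1 := Finset.mem_union_left _ hcC
      have hdU : d ∈ C'.1 ∪ D'.1 := Finset.mem_union_right _ hdD
      have hcd : c ≠ d := fun h => hcD (h ▸ hdD)
      set Y := (C'.1 ∪ D'.1).erase d with hYdef
      set Z := (C'.1 ∪ D'.1).erase c with hZdef
      have hCY : C'.1 ⊆ Y := fun z hz =>
        Finset.mem_erase.2 ⟨fun h => hdC (h ▸ hz), Finset.mem_union_left _ hz⟩
      have hDZ : D'.1 ⊆ Z := fun z hz =>
        Finset.mem_erase.2 ⟨fun h => hcD (h ▸ hz), Finset.mem_union_right _ hz⟩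
      have hY : IsSeparator G s t Y := C'.2.1.mono hCY
        (fun h => hU.notMem_left (Finset.mem_of_mem_erase h))
        (fun h => hU.notMem_right (Finset.mem_of_mem_erase h))
      have hZ : IsSeparator G s t Z := D'.2.1.mono hDZ
        (fun h => hU.notMem_left (Finset.mem_of_mem_erase h))
        (fun h => hU.notMem_right (Finset.mem_of_mem_erase h))
      have hYc : Y.card + 1 = (C'.1 ∪ D'.1).card := Finset.card_erase_add_one hdU
      have hZc : Z.card + 1 = (C'.1 ∪ D'.1).card := Finset.card_erase_add_one hcU
      have h1 : Y \ Z = {c} := by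
        ext z
        by_cases hz : z = c
        · subst hz
          simp only [hYdef, hZdef, Finset.mem_sdiff, Finset.mem_erase, Finset.mem_singleton]
          tauto
        · simp only [hYdef, hZdef, Finset.mem_sdiff, Finset.mem_erase, Finset.mem_singleton]
          tauto
      have h2 : Z \ Y = {d} := by
        ext z
        by_cases hz : z = d
        · subst hz
          simp only [hYdef, hZdef, Finset.mem_sdiff, Finset.mem_erase, Finset.mem_singleton]
          tauto
        · simp only [hYdef, hZdef, Finset.mem_sdiff, Finset.mem_erase, Finset.mem_singleton]
          tauto
      refine ⟨Z, hZ, by omega, hDZ, (hAX.trans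
        (TJ.of_common_subset C'.2.1 hX hY hCX hCY (by omega))).tail
          ⟨hY, hZ, by omega, by rw [h1, Finset.card_singleton], by rw [h2, Finset.card_singleton]⟩⟩

theorem TJ_iff_TAR (hA : IsSeparator G s t A) (hB : IsSeparator G s t B) :
    TJ G s t A B ↔ A.card = B.card ∧ TAR G s t A B (A.card + 1) := by
  refine ⟨fun h => ⟨h.card_eq, .of_TJ h⟩, fun ⟨hc, h⟩ => ?_⟩
  obtain ⟨A', hA', hmA⟩ := hA.exists_isMinSeparator
  obtain ⟨B', hB', hmB⟩ := hB.exists_isMinSeparator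
  rw [TAR_iff_reachable hA hB (by omega) (by omega) ⟨A', hmA⟩ ⟨B', hmB⟩ hA' hB'] at h
  obtain ⟨X, hX, hXc, hBX, hAX⟩ := TJ.of_reachable hA hA' h
  exact hAX.trans (TJ.of_common_subset hmB.1 hX hB hBX hB' (hXc.trans hc))

end Criterion

/-! ### Generating all minimal separators -/

section Generation

variable {V : Type*} [Fintype V] {G : SimpleGraph V} {s t : V}

open Classical in
/-- The vertices reached from `z` by walks avoiding `X`. -/
noncomputable def side (G : SimpleGraph V) (X : Finset V) (z : V) : Finset V :=
  Finset.univ.filter fun v => Conn G X z v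

open Classical in
/-- The closed neighbourhood `N[A]`. -/
noncomputable def nbhd (G : SimpleGraph V) (A : Finset V) : Finset V :=
  Finset.univ.filter fun v => v ∈ A ∨ ∃ u, u ∈ A ∧ G.Adj u v

open Classical in
/-- The open neighbourhood `N(D)`. -/
noncomputable def boundary (G : SimpleGraph V) (D : Finset V) : Finset V :=
  Finset.univ.filter fun v => v ∉ D ∧ ∃ u, u ∈ D ∧ G.Adj u v

/-- The part of `N(A)` that is seen from `t`. -/
noncomputable def cutOff (G : SimpleGraph V) (t : V) (A : Finset V) : Finset V :=
  boundary G (side G (nbhd G A) t)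

open Classical in
/-- Push the separator `S` over its vertex `x`, towards `t`: the component of `s` in `G - S` is
enlarged by `x` and cut off from `t` anew. -/
noncomputable def push (G : SimpleGraph V) (s t : V) (S : Finset V) (x : V) : Finset V :=
  cutOff G t (Finset.univ.filter fun v => v = x ∨ v ∈ side G S s)

theorem mem_side {X : Finset V} {z v : V} : v ∈ side G X z ↔ Conn G X z v := by simp [side]

theorem mem_nbhd {A : Finset V} {v : V} : v ∈ nbhd G A ↔ v ∈ A ∨ ∃ u, u ∈ A ∧ G.Adj u v := by
  simp [nbhd]

theorem mem_boundary {D : Finset V} {v : V} :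
    v ∈ boundary G D ↔ v ∉ D ∧ ∃ u, u ∈ D ∧ G.Adj u v := by
  simp [boundary]

theorem Conn.mem_of_boundary {D : Finset V} {a b : V} (h : Conn G (boundary G D) a b)
    (ha : a ∈ D) : b ∈ D := by
  induction h with
  | refl => exact ha
  | tail _ h ih =>
    by_contra hn
    exact h.2 (mem_boundary.2 ⟨hn, _, ih, h.1⟩)

theorem isSeparator_boundary {D : Finset V} (ht : t ∈ D) (hs : s ∉ D) (hs' : s ∉ boundary G D) :
    IsSeparator G s t (boundary G D) :=
  isSeparator_iff.2 ⟨hs', fun h => (mem_boundary.1 h).1 ht,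
    fun h => hs ((h.symm hs').mem_of_boundary ht)⟩

theorem isSeparator_boundary' {D : Finset V} (hs : s ∈ D) (ht : t ∉ D) (ht' : t ∉ boundary G D) :
    IsSeparator G s t (boundary G D) :=
  isSeparator_iff.2 ⟨fun h => (mem_boundary.1 h).1 hs, ht',
    fun h => ht (h.mem_of_boundary hs)⟩

theorem boundary_side_subset {S : Finset V} {z : V} : boundary G (side G S z) ⊆ S := by
  intro v hv
  obtain ⟨h1, u, hu, h2⟩ := mem_boundary.1 hv
  by_contra hn
  exact h1 (mem_side.2 ((mem_side.1 hu).tail ⟨h2, hn⟩))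

theorem IsMinSeparator.boundary_side_right {S : Finset V} (h : IsMinSeparator G s t S) :
    boundary G (side G S t) = S := by
  obtain ⟨hs, ht, hc⟩ := isSeparator_iff.1 h.1
  exact h.eq (isSeparator_boundary (mem_side.2 .refl)
    (fun h => hc ((mem_side.1 h).symm ht)) fun h => hs (boundary_side_subset h))
    boundary_side_subset

theorem IsMinSeparator.boundary_side_left {S : Finset V} (h : IsMinSeparator G s t S) :
    boundary G (side G S s) = S := by
  obtain ⟨hs, ht, hc⟩ := isSeparator_iff.1 h.1
  exact h.eq (isSeparator_boundary' (mem_side.2 .refl)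
    (fun h => hc (mem_side.1 h)) fun h => ht (boundary_side_subset h))
    boundary_side_subset

theorem side_mono {X Y : Finset V} (h : Y ⊆ X) (z : V) : side G X z ⊆ side G Y z :=
  fun _ hv => mem_side.2 ((mem_side.1 hv).mono h)

/-- The side of `t` in `G - N[A]` does not meet `N[A]`. -/
theorem notMem_nbhd_of_mem_side {A : Finset V} {v : V} (ht : t ∉ nbhd G A)
    (hv : v ∈ side G (nbhd G A) t) : v ∉ nbhd G A :=
  (mem_side.1 hv).notMem ht

/-- If `A` is connected and contains `s`, then every vertex of `cutOff G t A` has a neighbour on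
the side of `t` and one in `A`, so that no vertex can be left out. -/
theorem isMinSeparator_cutOff {A : Finset V} (hs : s ∈ A) (ht : t ∉ nbhd G A)
    (hA : ∀ a ∈ A, Relation.ReflTransGen (fun i j => G.Adj i j ∧ j ∈ A) s a) :
    IsMinSeparator G s t (cutOff G t A) := by
  have hdisj : ∀ v ∈ A, v ∉ cutOff G t A := by
    intro v hv h
    obtain ⟨-, u, hu, hadj⟩ := mem_boundary.1 h
    exact notMem_nbhd_of_mem_side ht hu (mem_nbhd.2 (.inr ⟨v, hv, hadj.symm⟩))
  refine ⟨isSeparator_boundary (mem_side.2 .refl)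
    (fun h => notMem_nbhd_of_mem_side ht h (mem_nbhd.2 (.inl hs))) (hdisj s hs), ?_⟩
  intro R hR hRS v hv
  by_contra hvR
  obtain ⟨hvD, u, hu, huv⟩ := mem_boundary.1 hv
  have hvN : v ∈ nbhd G A := by
    by_contra hn
    exact hvD (mem_side.2 ((mem_side.1 hu).tail ⟨huv, hn⟩))
  obtain ⟨a, ha, hav⟩ : ∃ a, a ∈ A ∧ G.Adj a v :=
    (mem_nbhd.1 hvN).resolve_left fun h => hdisj v h hv
  -- the walk from `s` through `A` to `v`, and on to `t`
  obtain ⟨hsR, htR, hc⟩ := isSeparator_iff.1 hR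
  have h1 : Conn G R s a :=
    Relation.ReflTransGen.mono (fun _ _ h => ⟨h.1, fun hj => hdisj _ h.2 (hRS hj)⟩) _ _ (hA a ha)
  have h2 : Conn G R t u := (mem_side.1 hu).mono fun x hx => by
    obtain ⟨hxD, y, hy, hyx⟩ := mem_boundary.1 (hRS hx)
    by_contra hn
    exact hxD (mem_side.2 ((mem_side.1 hy).tail ⟨hyx, hn⟩))
  exact hc (((h1.tail ⟨hav, hvR⟩).trans (.single ⟨huv.symm, h2.notMem htR⟩)).trans
    (h2.symm htR))

theorem isMinSeparator_cutOff_singleton (hst : s ≠ t) (hadj : ¬ G.Adj s t) :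
    IsMinSeparator G s t (cutOff G t {s}) := by
  refine isMinSeparator_cutOff (Finset.mem_singleton_self s) ?_ ?_
  · simp [mem_nbhd, hst.symm, hadj]
  · intro a ha
    rw [Finset.mem_singleton.1 ha]

theorem IsMinSeparator.push {S : Finset V} (h : IsMinSeparator G s t S) {x : V} (hx : x ∈ S)
    (hxt : ¬ G.Adj x t) : IsMinSeparator G s t (push G s t S x) := by
  classical
  obtain ⟨hs, ht, hc⟩ := isSeparator_iff.1 h.1
  refine isMinSeparator_cutOff (by simp [mem_side, Conn, Relation.ReflTransGen.refl]) ?_ ?_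
  · simp only [mem_nbhd, Finset.mem_filter, Finset.mem_univ, true_and, mem_side]
    rintro ((rfl | h) | ⟨u, rfl | hu, hadj⟩)
    · exact ht hx
    · exact hc h
    · exact hxt hadj
    · exact hc (hu.tail ⟨hadj, ht⟩)
  · have hside : ∀ a, Conn G S s a → Relation.ReflTransGen (fun i j => G.Adj i j ∧
        j ∈ Finset.univ.filter fun v => v = x ∨ v ∈ side G S s) s a := by
      intro a ha
      induction ha with
      | refl => exact .refl
      | tail h' h ih => exact ih.tail ⟨h.1, by simpa using .inr (mem_side.2 (h'.tail h))⟩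
    intro a ha
    simp only [Finset.mem_filter, Finset.mem_univ, true_and, mem_side] at ha
    rcases ha with rfl | ha
    · rw [← h.boundary_side_left] at hx
      obtain ⟨-, u, hu, hadj⟩ := mem_boundary.1 hx
      exact (hside u (mem_side.1 hu)).tail ⟨hadj, by simp⟩
    · exact hside a ha

/-- If `A` lies within the side of `s` of the separator `T`, then the side of `t` of `T` lies
within that of `cutOff G t A`. -/
theorem side_subset_side_cutOff {A T : Finset V} (hT : IsSeparator G s t T)
    (hA : A ⊆ side G T s) : side G T t ⊆ side G (cutOff G t A) t := by
  obtain ⟨hs, ht, hc⟩ := isSeparator_iff.1 hT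
  have hdisj : ∀ v, Conn G T t v → v ∉ nbhd G A := by
    intro v hv h
    rcases mem_nbhd.1 h with h | ⟨u, hu, huv⟩
    · exact hc ((mem_side.1 (hA h)).trans (hv.symm ht))
    · exact hc (((mem_side.1 (hA hu)).tail ⟨huv, hv.notMem ht⟩).trans (hv.symm ht))
  intro v hv
  have hv := mem_side.1 hv
  have h1 : ∀ w, Conn G T t w → Conn G (nbhd G A) t w := by
    intro w hw
    induction hw with
    | refl => exact .refl
    | tail h' h ih => exact ih.tail ⟨h.1, hdisj _ (h'.tail h)⟩
  exact mem_side.2 ((h1 v hv).mono boundary_side_subset)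

/-- The side of `t` of `cutOff G t A` is the one in `G - N[A]`. -/
theorem side_cutOff {A : Finset V} :
    side G (cutOff G t A) t = side G (nbhd G A) t := by
  refine Finset.Subset.antisymm (fun v hv => ?_) (side_mono boundary_side_subset t)
  exact (mem_side.1 hv).mem_of_boundary (mem_side.2 .refl)

/-- Starting from the neighbourhood of `s`, pushing generates every minimal separator `T`: as long
as the side of `t` is larger than that of `T`, some vertex of the current separator lies on the side
of `s` of `T`, and the separator can be pushed over it without crossing `T`. -/
theorem mem_of_push_closed {L : Set (Finset V)} (hL : ∀ S ∈ L, IsMinSeparator G s t S)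
    (h0 : cutOff G t {s} ∈ L)
    (hpush : ∀ S ∈ L, ∀ x ∈ S, ¬ G.Adj x t → push G s t S x ∈ L)
    {T : Finset V} (hT : IsMinSeparator G s t T) : T ∈ L := by
  obtain ⟨hs, ht, hc⟩ := isSeparator_iff.1 hT.1
  have key : ∀ n, ∀ S ∈ L, (side G S t).card = n → side G T t ⊆ side G S t → T ∈ L := by
    intro n
    induction n using Nat.strong_induction_on with
    | _ n ih =>
      intro S hS hn hTS
      have hmin := hL S hS
      obtain ⟨hsS, htS, hcS⟩ := isSeparator_iff.1 hmin.1
      -- the side of `s` of `S` lies within that of `T`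
      have hAS : side G S s ⊆ side G T s := by
        intro v hv
        replace hv := mem_side.1 hv
        refine mem_side.2 ?_
        induction hv with
        | refl => exact .refl
        | @tail a b h' h ih =>
          refine ih.tail ⟨h.1, fun hb => ?_⟩
          rw [← hT.boundary_side_right] at hb
          obtain ⟨-, u, hu, hub⟩ := mem_boundary.1 hb
          have htb : Conn G S t b := (mem_side.1 (hTS hu)).tail ⟨hub, h.2⟩
          exact hcS ((h'.tail h).trans (htb.symm htS))
      by_cases hmeet : ∃ x ∈ S, x ∈ side G T s
      · obtain ⟨x, hxS, hxT⟩ := hmeet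
        have hxt : ¬ G.Adj x t := fun h => hc ((mem_side.1 hxT).tail ⟨h, ht⟩)
        refine ih _ ?_ _ (hpush S hS x hxS hxt) rfl ?_
        · rw [← hn, push, side_cutOff]
          refine Finset.card_lt_card (Finset.ssubset_iff_subset_ne.2 ⟨side_mono ?_ t, ?_⟩)
          · intro v hv
            rw [← hmin.boundary_side_left] at hv
            obtain ⟨-, u, hu, huv⟩ := mem_boundary.1 hv
            exact mem_nbhd.2 (.inr ⟨u, by simp [hu], huv⟩)
          · -- a neighbour of `x` on the side of `t` is lost
            rw [← hmin.boundary_side_right] at hxS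
            obtain ⟨-, u, hu, hux⟩ := mem_boundary.1 hxS
            intro heq
            rw [← heq] at hu
            refine (mem_side.1 hu).notMem ?_ (mem_nbhd.2 (.inr ⟨x, by simp, hux.symm⟩))
            simp only [mem_nbhd, Finset.mem_filter, Finset.mem_univ, true_and]
            rintro ((rfl | h) | ⟨w, rfl | hw, hadj⟩)
            · exact hc (mem_side.1 hxT)
            · exact hcS (mem_side.1 h)
            · exact hxt hadj
            · exact hcS ((mem_side.1 hw).tail ⟨hadj, htS⟩)
        · refine side_subset_side_cutOff hT.1 fun v hv => ?_
          simp only [Finset.mem_filter, Finset.mem_univ, true_and] at hv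
          rcases hv with rfl | hv
          · exact hxT
          · exact hAS hv
      · -- both sides of `s` agree, and so do their neighbourhoods `S` and `T`
        have hTA : side G T s ⊆ side G S s := by
          intro v hv
          replace hv := mem_side.1 hv
          refine mem_side.2 ?_
          induction hv with
          | refl => exact .refl
          | tail h' h ih =>
            exact ih.tail ⟨h.1, fun hb => hmeet ⟨_, hb, mem_side.2 (h'.tail h)⟩⟩
        rw [← hT.boundary_side_left, Finset.Subset.antisymm hTA hAS, hmin.boundary_side_left]
        exact hS
  exact key _ _ h0 rfl (side_subset_side_cutOff hT.1 fun v hv => by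
    rw [Finset.mem_singleton.1 hv]
    exact mem_side.2 .refl)

end Generation

/-! ### The list of all minimal separators -/

section List

variable {n : ℕ} (G : SimpleGraph (Fin n)) (s t : Fin n) (M : ℕ)

/-- Pushing row `m`, one of the first `r` rows, over its vertex `x` gives a set that is not among
the first `r` rows. -/
def Fresh (r : ℕ) (R : ℕ → Finset (Fin n)) (m : Fin M) (x : Fin n) : Prop :=
  m.val < r ∧ x ∈ R m ∧ ¬ G.Adj x t ∧ ∀ i : Fin M, i.val < r → push G s t (R m) x ≠ R i

/-- The lexicographically first pair with the property `Fresh`. -/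
def FirstFresh (r : ℕ) (R : ℕ → Finset (Fin n)) (m : Fin M) (x : Fin n) : Prop :=
  Fresh G s t M r R m x ∧
    ∀ m' x', Fresh G s t M r R m' x' → m.val < m'.val ∨ m.val = m'.val ∧ x.val ≤ x'.val

open Classical in
/-- Row `0` is the minimal separator next to `s`. Every other row is a new separator obtained by
pushing an earlier row, and a copy of row `0` if there is none. -/
noncomputable def listStep (r : ℕ) (R : ℕ → Finset (Fin n)) : Finset (Fin n) :=
  Finset.univ.filter fun v => (r = 0 ∧ v ∈ cutOff G t {s}) ∨
    (∃ m, ∃ x, FirstFresh G s t M r R m x ∧ v ∈ push G s t (R m) x) ∨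
    ((¬ ∃ m, ∃ x, Fresh G s t M r R m x) ∧ v ∈ R 0)

variable {G s t M}

theorem exists_firstFresh {r : ℕ} {R : ℕ → Finset (Fin n)}
    (h : ∃ m, ∃ x, Fresh G s t M r R m x) : ∃ m, ∃ x, FirstFresh G s t M r R m x := by
  classical
  obtain ⟨m, x, h⟩ := h
  obtain ⟨p, hp, hmin⟩ := Finset.exists_min_image
    (Finset.univ.filter fun p : Fin M × Fin n => Fresh G s t M r R p.1 p.2) toLex
    ⟨(m, x), by simpa using h⟩
  refine ⟨p.1, p.2, by simpa using hp, fun m' x' h' => ?_⟩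
  exact (Prod.Lex.toLex_le_toLex.1 (hmin (m', x') (by simpa using h'))).imp id
    fun ⟨h1, h2⟩ => ⟨congrArg Fin.val h1, h2⟩

theorem listStep_of_firstFresh {r : ℕ} {R : ℕ → Finset (Fin n)} {m : Fin M} {x : Fin n}
    (h : FirstFresh G s t M r R m x) : listStep G s t M r R = push G s t (R m) x := by
  have hr : r ≠ 0 := fun h0 => by
    have := h.1.1
    omega
  have hex : ∃ m, ∃ x, Fresh G s t M r R m x := ⟨m, x, h.1⟩
  ext v
  simp only [listStep, Finset.mem_filter, Finset.mem_univ, true_and, hr, false_and, hex,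
    not_true_eq_false, false_or, or_false]
  constructor
  · rintro ⟨m', x', h', hv⟩
    have h1 := h.2 _ _ h'.1
    have h2 := h'.2 _ _ h.1
    obtain rfl : m = m' := Fin.ext (by omega)
    obtain rfl : x = x' := Fin.ext (by omega)
    exact hv
  · exact fun hv => ⟨m, x, h, hv⟩

theorem listStep_of_not_fresh {r : ℕ} {R : ℕ → Finset (Fin n)} (hr : r ≠ 0)
    (h : ¬ ∃ m, ∃ x, Fresh G s t M r R m x) : listStep G s t M r R = R 0 := by
  ext v
  simp only [listStep, Finset.mem_filter, Finset.mem_univ, true_and, hr, false_and, h,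
    not_false_eq_true, false_or]
  refine ⟨fun hv => hv.resolve_left fun ⟨m, x, hf, _⟩ => h ⟨m, x, hf.1⟩, .inr⟩

theorem listStep_zero : listStep G s t M 0 (rows (listStep G s t M) 0) = cutOff G t {s} := by
  ext v
  simp [listStep, FirstFresh, Fresh, rows]

/-- Either the first `r` rows are closed under pushing, or they are distinct: a row that is not
new is written only when there is nothing new. -/
theorem pushClosed_or_card_eq {r : ℕ} (hr : r < M) :
    (∀ m ≤ r, ∀ x ∈ rows (listStep G s t M) (m + 1) m, ¬ G.Adj x t →
      ∃ i ≤ r, push G s t (rows (listStep G s t M) (m + 1) m) x =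
        rows (listStep G s t M) (i + 1) i) ∨
    ((Finset.range (r + 1)).image fun i => rows (listStep G s t M) (i + 1) i).card = r + 1 := by
  set f : ℕ → Finset (Fin n) := fun i => rows (listStep G s t M) (i + 1) i with hf
  change (∀ m ≤ r, ∀ x ∈ f m, ¬ G.Adj x t → ∃ i ≤ r, push G s t (f m) x = f i) ∨
    ((Finset.range (r + 1)).image f).card = r + 1
  have hR : ∀ {m r}, m < r → rows (listStep G s t M) r m = f m := fun h =>
    (rows_of_lt _ h).trans (rows_of_lt _ (Nat.lt_succ_self _)).symm
  have hfr : ∀ r, f r = listStep G s t M r (rows (listStep G s t M) r) := fun r =>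
    rows_of_lt _ (Nat.lt_succ_self r)
  induction r with
  | zero => right; simp
  | succ r ih =>
    by_cases hfresh : ∃ m, ∃ x, Fresh G s t M (r + 1) (rows (listStep G s t M) (r + 1)) m x
    · right
      obtain ⟨m, x, h⟩ := exists_firstFresh hfresh
      have h1 : f (r + 1) = push G s t (rows (listStep G s t M) (r + 1) m) x := by
        rw [hfr, listStep_of_firstFresh h]
      obtain ⟨⟨hm, hx, hxt, hnew⟩, -⟩ := h
      rw [← h1] at hnew
      have hcard := (ih (by omega)).resolve_left fun hcl => by
        rw [hR hm] at hx h1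
        obtain ⟨i, hi, he⟩ := hcl m (by omega) x hx hxt
        refine hnew ⟨i, by omega⟩ (by simp only; omega) ?_
        rw [hR (by simp only; omega), h1, he]
      rw [Finset.range_add_one, Finset.image_insert, Finset.card_insert_of_notMem, hcard]
      intro hmem
      obtain ⟨i, hi, he⟩ := Finset.mem_image.1 hmem
      rw [Finset.mem_range] at hi
      refine hnew ⟨i, by omega⟩ hi ?_
      rw [hR hi, he]
    · left
      have h0 : f (r + 1) = f 0 := by
        rw [hfr, listStep_of_not_fresh (Nat.succ_ne_zero r) hfresh, hR (Nat.succ_pos r)]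
      have hcl : ∀ m ≤ r, ∀ x ∈ f m, ¬ G.Adj x t → ∃ i ≤ r, push G s t (f m) x = f i := by
        intro m hm x hx hxt
        by_contra hno
        refine hfresh ⟨⟨m, by omega⟩, x, by simp only; omega, ?_, hxt, fun i hi he => ?_⟩
        · rwa [hR (by simp only; omega)]
        · rw [hR (by simp only; omega), hR hi] at he
          exact hno ⟨i, by omega, he⟩
      intro m hm x hx hxt
      obtain ⟨m', hm', he⟩ : ∃ m' ≤ r, f m = f m' := by
        by_cases h : m = r + 1
        · exact ⟨0, Nat.zero_le r, by rw [h, h0]⟩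
        · exact ⟨m, by omega, rfl⟩
      rw [he] at hx ⊢
      obtain ⟨i, hi, he'⟩ := hcl m' hm' x hx hxt
      exact ⟨i, by omega, he'⟩

/-- If there are fewer than `M` minimal separators, then the table of `M` rows lists them all. -/
theorem isMinSeparator_iff_exists_row (hst : s ≠ t) (hadj : ¬ G.Adj s t)
    (hM : (minSeparators G).ncard < M) (S : Finset (Fin n)) :
    IsMinSeparator G s t S ↔ ∃ i : Fin M, rows (listStep G s t M) M i = S := by
  set f : ℕ → Finset (Fin n) := fun i => rows (listStep G s t M) (i + 1) i with hf
  have hR : ∀ {m r}, m < r → rows (listStep G s t M) r m = f m := fun h =>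
    (rows_of_lt _ h).trans (rows_of_lt _ (Nat.lt_succ_self _)).symm
  have hfr : ∀ r, f r = listStep G s t M r (rows (listStep G s t M) r) := fun r =>
    rows_of_lt _ (Nat.lt_succ_self r)
  have h0 : f 0 = cutOff G t {s} := by rw [hfr, listStep_zero]
  have hmin : ∀ r, IsMinSeparator G s t (f r) := by
    intro r
    induction r using Nat.strong_induction_on with
    | _ r ih =>
      rcases Nat.eq_zero_or_pos r with rfl | hr
      · rw [h0]
        exact isMinSeparator_cutOff_singleton hst hadj
      rw [hfr]
      by_cases hfresh : ∃ m, ∃ x, Fresh G s t M r (rows (listStep G s t M) r) m x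
      · obtain ⟨m, x, h⟩ := exists_firstFresh hfresh
        rw [listStep_of_firstFresh h]
        obtain ⟨⟨hm, hx, hxt, -⟩, -⟩ := h
        rw [hR hm] at hx ⊢
        exact (ih m hm).push hx hxt
      · rw [listStep_of_not_fresh hr.ne' hfresh, hR hr]
        exact ih 0 hr
  have hM0 : 0 < M := by omega
  constructor
  · intro hS
    have hclosed := (pushClosed_or_card_eq (G := G) (s := s) (t := t)
      (show M - 1 < M by omega)).resolve_right fun hcard => by
        have hsub : (((Finset.range (M - 1 + 1)).image f : Finset _) : Set (Finset (Fin n))) ⊆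
            minSeparators G := by
          intro X hX
          obtain ⟨i, -, rfl⟩ := Finset.mem_image.1 (Finset.mem_coe.1 hX)
          exact ⟨s, t, hmin i⟩
        have := Set.ncard_le_ncard hsub (Set.toFinite _)
        rw [Set.ncard_coe_finset, hcard] at this
        omega
    obtain ⟨i, hi, rfl⟩ := mem_of_push_closed (L := {S | ∃ i ≤ M - 1, f i = S})
      (by rintro _ ⟨i, -, rfl⟩; exact hmin i) ⟨0, by omega, h0⟩
      (by
        rintro _ ⟨m, hm, rfl⟩ x hx hxt
        obtain ⟨i, hi, he⟩ := hclosed m hm x hx hxt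
        exact ⟨i, hi, he.symm⟩) hS
    exact ⟨⟨i, by omega⟩, hR (by simp only; omega)⟩
  · rintro ⟨i, rfl⟩
    rw [hR i.isLt]
    exact hmin i

end List

/-! ### The decision procedure -/

section Decision

variable {n : ℕ} {G : SimpleGraph (Fin n)} {s t : Fin n} {A B : Finset (Fin n)} {k M : ℕ}

/-- What is checked on the list `R` of minimal separators: one that lies in `A` and one that lies
in `B` are linked by overlaps of size at most `k`. -/
def Linked (M : ℕ) (A B : Finset (Fin n)) (k : ℕ) (R : ℕ → Finset (Fin n)) : Prop :=
  ∃ i : Fin M, ∃ j : Fin M, (R i ⊆ A ∧ R j ⊆ B) ∧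
    Relation.ReflTransGen (fun i j : Fin M => (R i ∪ R j).card ≤ k) i j

theorem linked_iff_TAR (hA : IsSeparator G s t A) (hB : IsSeparator G s t B) (hAk : A.card ≤ k)
    (hBk : B.card ≤ k) {R : ℕ → Finset (Fin n)}
    (hR : ∀ S, IsMinSeparator G s t S ↔ ∃ i : Fin M, R i = S) :
    Linked M A B k R ↔ TAR G s t A B k := by
  constructor
  · rintro ⟨i, j, ⟨hi, hj⟩, h⟩
    have hmin : ∀ i : Fin M, IsMinSeparator G s t (R i) := fun i => (hR _).2 ⟨i, rfl⟩
    rw [TAR_iff_reachable hA hB hAk hBk ⟨R i, hmin i⟩ ⟨R j, hmin j⟩ hi hj]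
    clear hj
    induction h with
    | refl => exact .refl _
    | tail _ h ih => exact ih.trans (overlapGraph_reachable_of_card_union_le h)
  · intro h
    obtain ⟨A', hA', hmA⟩ := hA.exists_isMinSeparator
    obtain ⟨B', hB', hmB⟩ := hB.exists_isMinSeparator
    rw [TAR_iff_reachable hA hB hAk hBk ⟨A', hmA⟩ ⟨B', hmB⟩ hA' hB',
      SimpleGraph.reachable_iff_reflTransGen] at h
    choose g hg using fun S : {S // IsMinSeparator G s t S} => (hR S.1).1 S.2
    refine ⟨g ⟨A', hmA⟩, g ⟨B', hmB⟩, ⟨by rwa [hg], by rwa [hg]⟩, ?_⟩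
    refine Relation.ReflTransGen.lift g (fun S T hST => ?_) _ _ h
    change (R (g S) ∪ R (g T)).card ≤ k
    rw [hg, hg]
    exact hST.2

end Decision

/-! ### The decision procedure is polynomial -/

section Computability

variable {Γ : Type} {C : Ctx Γ} {n : Γ → ℕ}

theorem CompSet.subset {S T : ∀ γ, Finset (Fin (n γ))} (hn : Bound C n) (hS : CompSet C S)
    (hT : CompSet C T) : CompP C (fun γ => S γ ⊆ T γ) :=
  CompPred.forall (P := fun γ x => x ∈ S γ → x ∈ T γ) hn
    fun _ C' f hf x hx => (hS C' f hf x hx).imp (hT C' f hf x hx)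

theorem CompSet.eq {S T : ∀ γ, Finset (Fin (n γ))} (hn : Bound C n) (hS : CompSet C S)
    (hT : CompSet C T) : CompP C (fun γ => S γ = T γ) :=
  ((CompSet.subset hn hS hT).and (CompSet.subset hn hT hS)).congr fun _ =>
    Finset.Subset.antisymm_iff

theorem CompSet.union {S T : ∀ γ, Finset (Fin (n γ))} (hS : CompSet C S) (hT : CompSet C T) :
    CompSet C (fun γ => S γ ∪ T γ) :=
  fun _ C' f hf x hx => ((hS C' f hf x hx).or (hT C' f hf x hx)).congr fun _ => Finset.mem_union

theorem CompSet.singleton {a : ∀ γ, Fin (n γ)} (ha : Comp C (fun γ => (a γ : ℕ))) :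
    CompSet C (fun γ => {a γ}) :=
  fun _ _ _ hf _ hx => (hx.eq (ha.lift hf)).congr fun _ =>
    Finset.mem_singleton.trans Fin.ext_iff

variable {G : ∀ γ, SimpleGraph (Fin (n γ))}

theorem CompSet.side (hn : Bound C n) (hG : CompRel C (fun γ => (G γ).Adj))
    {X : ∀ γ, Finset (Fin (n γ))} (hX : CompSet C X) {z : ∀ γ, Fin (n γ)}
    (hz : Comp C (fun γ => (z γ : ℕ))) : CompSet C (fun γ => side (G γ) (X γ) (z γ)) := by
  intro Γ' C' f hf x hx
  refine (CompRel.reflTransGen (hn.lift hf)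
    (E := fun γ' i j => (G (f γ')).Adj i j ∧ j ∉ X (f γ')) ?_ (hz.lift hf) hx).congr
    fun γ => mem_side
  intro Γ'' C'' g hg i j hi hj
  exact (hG C'' _ (hg.trans hf) i j hi hj).and (hX C'' _ (hg.trans hf) j hj).not

theorem CompSet.exists_adj (hn : Bound C n) (hG : CompRel C (fun γ => (G γ).Adj))
    {A : ∀ γ, Finset (Fin (n γ))} (hA : CompSet C A) :
    CompPred C (fun γ v => ∃ u, u ∈ A γ ∧ (G γ).Adj u v) := by
  intro Γ' C' f hf x hx
  refine CompPred.exists (hn.lift hf) fun Γ'' C'' g hg u hu => ?_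
  exact (hA C'' _ (hg.trans hf) u hu).and (hG C'' _ (hg.trans hf) u _ hu (hx.lift hg))

theorem CompSet.nbhd (hn : Bound C n) (hG : CompRel C (fun γ => (G γ).Adj))
    {A : ∀ γ, Finset (Fin (n γ))} (hA : CompSet C A) : CompSet C (fun γ => nbhd (G γ) (A γ)) :=
  fun _ C' f hf x hx => ((hA C' f hf x hx).or
    (CompSet.exists_adj hn hG hA C' f hf x hx)).congr fun _ => mem_nbhd

theorem CompSet.boundary (hn : Bound C n) (hG : CompRel C (fun γ => (G γ).Adj))
    {D : ∀ γ, Finset (Fin (n γ))} (hD : CompSet C D) :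
    CompSet C (fun γ => boundary (G γ) (D γ)) :=
  fun _ C' f hf x hx => ((hD C' f hf x hx).not.and
    (CompSet.exists_adj hn hG hD C' f hf x hx)).congr fun _ => mem_boundary

variable {s t : ∀ γ, Fin (n γ)}

theorem CompSet.cutOff (hn : Bound C n) (hG : CompRel C (fun γ => (G γ).Adj))
    (ht : Comp C (fun γ => (t γ : ℕ))) {A : ∀ γ, Finset (Fin (n γ))} (hA : CompSet C A) :
    CompSet C (fun γ => cutOff (G γ) (t γ) (A γ)) :=
  CompSet.boundary hn hG (CompSet.side hn hG (CompSet.nbhd hn hG hA) ht)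

theorem CompSet.push (hn : Bound C n) (hG : CompRel C (fun γ => (G γ).Adj))
    (hs : Comp C (fun γ => (s γ : ℕ))) (ht : Comp C (fun γ => (t γ : ℕ)))
    {S : ∀ γ, Finset (Fin (n γ))} (hS : CompSet C S) {x : ∀ γ, Fin (n γ)}
    (hx : Comp C (fun γ => (x γ : ℕ))) :
    CompSet C (fun γ => push (G γ) (s γ) (t γ) (S γ) (x γ)) := by
  refine CompSet.cutOff hn hG ht fun Γ' C' f hf v hv => ?_
  exact ((hv.eq (hx.lift hf)).or (CompSet.side hn hG hS hs C' f hf v hv)).congr fun _ => by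
    simp [Fin.ext_iff]

variable {M : Γ → ℕ} {r : Γ → ℕ} {R : ∀ γ, ℕ → Finset (Fin (n γ))}

theorem CompRel.fresh (hn : Bound C n) (hM : Bound C M) (hG : CompRel C (fun γ => (G γ).Adj))
    (hs : Comp C (fun γ => (s γ : ℕ))) (ht : Comp C (fun γ => (t γ : ℕ))) (hr : Comp C r)
    (hR : CompRows C R) :
    CompRel C (fun γ => Fresh (G γ) (s γ) (t γ) (M γ) (r γ) (R γ)) := by
  intro Γ' C' f hf m x hm hx
  refine (hm.lt (hr.lift hf)).and ((hR C' f hf _ x hm hx).and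
    ((hG C' f hf x _ hx (ht.lift hf)).not.and ?_))
  refine CompPred.forall (hM.lift hf) fun Γ'' C'' g hg i hi => ?_
  have hgf := hg.trans hf
  refine (hi.lt (hr.lift hgf)).imp (CompP.not ?_)
  exact CompSet.eq (hn.lift hgf) (CompSet.push (hn.lift hgf) (hG.lift hgf) (hs.lift hgf)
    (ht.lift hgf) ((hR.lift hgf).row (hm.lift hg)) (hx.lift hg)) ((hR.lift hgf).row hi)

theorem CompRel.exists₂ {N M : Γ → ℕ} {E : ∀ γ, Fin (M γ) → Fin (N γ) → Prop} (hM : Bound C M)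
    (hN : Bound C N) (hE : CompRel C E) : CompP C (fun γ => ∃ x, ∃ y, E γ x y) :=
  CompPred.exists hM fun _ _ _ hf _ hx => CompPred.exists (hN.lift hf)
    fun _ C'' _ hg y hy => hE C'' _ (hg.trans hf) _ y (hx.lift hg) hy

theorem CompRel.forall₂ {N M : Γ → ℕ} {E : ∀ γ, Fin (M γ) → Fin (N γ) → Prop} (hM : Bound C M)
    (hN : Bound C N) (hE : CompRel C E) : CompP C (fun γ => ∀ x, ∀ y, E γ x y) :=
  CompPred.forall hM fun _ _ _ hf _ hx => CompPred.forall (hN.lift hf)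
    fun _ C'' _ hg y hy => hE C'' _ (hg.trans hf) _ y (hx.lift hg) hy

theorem CompSet.listStep (hn : Bound C n) (hM : Bound C M) (hG : CompRel C (fun γ => (G γ).Adj))
    (hs : Comp C (fun γ => (s γ : ℕ))) (ht : Comp C (fun γ => (t γ : ℕ))) (hr : Comp C r)
    (hR : CompRows C R) :
    CompSet C (fun γ => listStep (G γ) (s γ) (t γ) (M γ) (r γ) (R γ)) := by
  have hfresh := CompRel.fresh hn hM hG hs ht hr hR
  have hfirst : CompRel C (fun γ => FirstFresh (G γ) (s γ) (t γ) (M γ) (r γ) (R γ)) := by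
    intro Γ' C' f hf m x hm hx
    refine (hfresh C' f hf m x hm hx).and (CompRel.forall₂ (hM.lift hf) (hn.lift hf)
      fun Γ'' C'' g hg m' x' hm' hx' => ?_)
    exact (hfresh C'' _ (hg.trans hf) m' x' hm' hx').imp (((hm.lift hg).lt hm').or
      (((hm.lift hg).eq hm').and ((hx.lift hg).le hx')))
  intro Γ' C' f hf v hv
  have h1 := ((hr.lift hf).eq (Comp.const C' 0)).and (CompSet.cutOff hn hG ht
    (CompSet.singleton hs) C' f hf v hv)
  have h2 := CompRel.exists₂ (hM.lift hf) (hn.lift hf)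
    (E := fun γ' m x => FirstFresh (G (f γ')) (s (f γ')) (t (f γ')) (M (f γ')) (r (f γ'))
      (R (f γ')) m x ∧ v γ' ∈ SepReconf.push (G (f γ')) (s (f γ')) (t (f γ')) (R (f γ') m) x)
    fun Γ'' C'' g hg m x hm hx => (hfirst C'' _ (hg.trans hf) m x hm hx).and
      (CompSet.push (hn.lift (hg.trans hf)) (hG.lift (hg.trans hf)) (hs.lift (hg.trans hf))
        (ht.lift (hg.trans hf)) ((hR.lift (hg.trans hf)).row hm) hx C'' id (Extends.refl C'') _
        (hv.lift hg))
  have h3 := (CompRel.exists₂ hM hn hfresh).not.lift hf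
  exact (h1.or (h2.or (h3.and (hR C' f hf _ v (Comp.const C' 0) hv)))).congr fun _ => by
    simp [SepReconf.listStep]

theorem CompP.linked (hn : Bound C n) (hM : Bound C M) (hR : CompRows C R)
    {A B : ∀ γ, Finset (Fin (n γ))} (hA : CompSet C A) (hB : CompSet C B) {k : Γ → ℕ}
    (hk : Comp C k) : CompP C (fun γ => Linked (M γ) (A γ) (B γ) (k γ) (R γ)) := by
  refine CompRel.exists₂ hM hM (E := fun γ i j => (R γ i ⊆ A γ ∧ R γ j ⊆ B γ) ∧
    Relation.ReflTransGen (fun i j : Fin (M γ) => (R γ i ∪ R γ j).card ≤ k γ) i j)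
    fun Γ' C' f hf i j hi hj => ?_
  refine ((CompSet.subset (hn.lift hf) ((hR.lift hf).row hi) (hA.lift hf)).and
    (CompSet.subset (hn.lift hf) ((hR.lift hf).row hj) (hB.lift hf))).and ?_
  refine CompRel.reflTransGen (hM.lift hf)
    (E := fun γ' i j => (R (f γ') i ∪ R (f γ') j).card ≤ k (f γ'))
    (fun Γ'' C'' g hg i j hi hj => ?_) hi hj
  have hgf := hg.trans hf
  exact (CompSet.card (hn.lift hgf)
    (CompSet.union ((hR.lift hgf).row hi) ((hR.lift hgf).row hj))).le (hk.lift hgf)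

theorem CompP.linked_rows (hn : Bound C n) (hM : Bound C M) (hG : CompRel C (fun γ => (G γ).Adj))
    (hs : Comp C (fun γ => (s γ : ℕ))) (ht : Comp C (fun γ => (t γ : ℕ)))
    {A B : ∀ γ, Finset (Fin (n γ))} (hA : CompSet C A) (hB : CompSet C B) {k : Γ → ℕ}
    (hk : Comp C k) :
    CompP C (fun γ => Linked (M γ) (A γ) (B γ) (k γ)
      (SepReconf.rows (SepReconf.listStep (G γ) (s γ) (t γ) (M γ)) (M γ))) :=
  CompP.rows hn hM (step := fun γ => SepReconf.listStep (G γ) (s γ) (t γ) (M γ))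
    (g := fun γ R => Linked (M γ) (A γ) (B γ) (k γ) R)
    (fun _ C' _ hf _ _ _ hr hR hx => CompSet.listStep (hn.lift hf) (hM.lift hf) (hG.lift hf)
      (hs.lift hf) (ht.lift hf) hr hR C' id (Extends.refl C') _ hx)
    (fun _ _ _ hf _ hR => CompP.linked (hn.lift hf) (hM.lift hf) hR (hA.lift hf) (hB.lift hf)
      (hk.lift hf))

end Computability

/-! ### Instances in the input encoding -/

/-- An instance of the reconfiguration problem. -/
structure Input where
  n : ℕ
  G : SimpleGraph (Fin n)
  s : Fin n
  t : Fin n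
  A : Finset (Fin n)
  B : Finset (Fin n)
  k : ℕ

/-- The initial memory holds the instance. -/
def inputCtx : Ctx Input where
  v := 5
  rep γ σ := ∀ a < 5, a ≠ 4 → σ a = encode γ.G γ.s γ.t γ.A γ.B γ.k a
  size γ := γ.n
  lt_v := by omega
  size_eq h := by rw [h 0 (by omega) (by omega)]; rfl
  stable h hk a ha h4 := by rw [hk a ha h4, h a ha h4]

theorem bound_input_n : Bound inputCtx Input.n := Bound.size inputCtx

theorem comp_input_s : Comp inputCtx (fun γ => (γ.s : ℕ)) :=
  Comp.read 0 (Comp.const _ 1) fun γ σ h => by rw [h 0 (by omega) (by omega)]; rfl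

theorem comp_input_t : Comp inputCtx (fun γ => (γ.t : ℕ)) :=
  Comp.read 0 (Comp.const _ 2) fun γ σ h => by rw [h 0 (by omega) (by omega)]; rfl

theorem comp_input_k : Comp inputCtx Input.k :=
  Comp.read 0 (Comp.const _ 3) fun γ σ h => by rw [h 0 (by omega) (by omega)]; rfl

theorem compSet_input_A : CompSet inputCtx Input.A := by
  intro Γ' C' f hf x hx
  refine Comp.read 2 hx fun γ' σ h => ?_
  rw [hf.rep h 2 (by omega) (by omega)]
  simp [encode, ← Fin.ext_iff]

theorem compSet_input_B : CompSet inputCtx Input.B := by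
  intro Γ' C' f hf x hx
  refine Comp.read 3 hx fun γ' σ h => ?_
  rw [hf.rep h 3 (by omega) (by omega)]
  simp [encode, ← Fin.ext_iff]

theorem compRel_input_adj : CompRel inputCtx (fun γ => γ.G.Adj) := by
  intro Γ' C' f hf x y hx hy
  refine Comp.read 1 ((hx.mul (bound_input_n.lift hf)).add hy) fun γ' σ h => ?_
  rw [hf.rep h 1 (by omega) (by omega)]
  have key : (∃ i j : Fin (f γ').n, x γ' * (f γ').n + y γ' = i.val * (f γ').n + j.val ∧
      (f γ').G.Adj i j) ↔ (f γ').G.Adj (x γ') (y γ') := by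
    constructor
    · rintro ⟨i, j, h, hij⟩
      -- division with remainder by `n`
      have h' : ∀ a b : Fin (f γ').n, (a.val * (f γ').n + b.val) / (f γ').n = a.val ∧
          (a.val * (f γ').n + b.val) % (f γ').n = b.val := by
        intro a b
        have hpos : 0 < (f γ').n := a.pos
        rw [add_comm, Nat.add_mul_div_right _ _ hpos, Nat.div_eq_of_lt b.isLt,
          Nat.add_mul_mod_self_right, Nat.mod_eq_of_lt b.isLt]
        simp
      obtain rfl : x γ' = i := Fin.ext (by rw [← (h' _ (y γ')).1, h, (h' i j).1])
      obtain rfl : y γ' = j := Fin.ext (by rw [← (h' (x γ') _).2, h, (h' _ j).2])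
      exact hij
    · exact fun h => ⟨_, _, rfl, h⟩
  by_cases hadj : (f γ').G.Adj (x γ') (y γ')
  · exact (if_pos (key.2 hadj)).trans (if_pos hadj).symm
  · exact (if_neg fun h => hadj (key.1 h)).trans (if_neg hadj).symm

/-- A property of instances that is decidable in polynomial time in the sense of the calculus is
decided by a program within a polynomial bound. -/
theorem CompP.exists_decidesWithin {P : Input → Prop} (h : CompP inputCtx P) :
    ∃ (p : Prog) (T : Polynomial ℕ), ∀ γ : Input,
      DecidesWithin p (encode γ.G γ.s γ.t γ.A γ.B γ.k) (T.eval γ.n) (P γ) := by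
  obtain ⟨p, T, hp⟩ := h 5 le_rfl 0
  refine ⟨.seq p (.write 0 (.const 0) (.read 4 (.const 0))), T + Polynomial.C 4, fun γ => ?_⟩
  have := Runs.seq (R := fun σ' => σ' 0 0 ≠ 0 ↔ P γ) (hp γ _ fun a _ _ => rfl)
    (fun σ' ⟨_, e⟩ => Runs.write (a := 0) (i := .const 0) (e := .read 4 (.const 0)) (by
      simp only [Expr.eval, Store.put_same, e]
      by_cases h : P γ <;> simp [h]))
  rw [Polynomial.eval_add, Polynomial.eval_C]
  exact this

/-! ### Tame classes -/

section Tame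

variable {n : ℕ} {G : SimpleGraph (Fin n)} {s t : Fin n} {A B : Finset (Fin n)} {k M : ℕ}

theorem IsSeparator.ne (h : IsSeparator G s t A) : s ≠ t := fun he =>
  (isSeparator_iff.1 h).2.2 (he ▸ .refl)

theorem IsSeparator.not_adj (h : IsSeparator G s t A) : ¬ G.Adj s t := fun hadj =>
  (isSeparator_iff.1 h).2.2 (.single ⟨hadj, h.notMem_right⟩)

theorem TAR_iff_linked_rows (hA : IsSeparator G s t A) (hB : IsSeparator G s t B)
    (hM : (minSeparators G).ncard < M) :
    TAR G s t A B k ↔ A = B ∨ ((A.card ≤ k ∧ B.card ≤ k) ∧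
      Linked M A B k (rows (listStep G s t M) M)) := by
  by_cases hk : A.card ≤ k ∧ B.card ≤ k
  · rw [linked_iff_TAR hA hB hk.1 hk.2 (isMinSeparator_iff_exists_row hA.ne hA.not_adj hM)]
    refine ⟨fun h => .inr ⟨hk, h⟩, ?_⟩
    rintro (rfl | h)
    · exact .refl
    · exact h.2
  · rw [TAR_iff_eq hk]
    simp [hk]

theorem TAR_polyTimeSolvable {𝒢 : GraphClass} (h𝒢 : Tame 𝒢) : TARPolyTimeSolvable 𝒢 := by
  obtain ⟨q, hq⟩ := h𝒢
  have hM := Bound.poly inputCtx (q + 1)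
  obtain ⟨p, T, h⟩ := CompP.exists_decidesWithin
    ((CompSet.eq bound_input_n compSet_input_A compSet_input_B).or
      ((((CompSet.card bound_input_n compSet_input_A).le comp_input_k).and
        ((CompSet.card bound_input_n compSet_input_B).le comp_input_k)).and
      (CompP.linked_rows bound_input_n hM compRel_input_adj comp_input_s comp_input_t
        compSet_input_A compSet_input_B comp_input_k)))
  refine ⟨p, T, fun n G hG s t A B k hA hB => ?_⟩
  obtain ⟨τ, σ', h1, h2, h3⟩ := h ⟨n, G, s, t, A, B, k⟩
  refine ⟨τ, σ', h1, h2, h3.trans (TAR_iff_linked_rows hA hB ?_).symm⟩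
  exact (hq n G hG).trans_lt (by simp [inputCtx])

theorem TJ_polyTimeSolvable {𝒢 : GraphClass} (h𝒢 : Tame 𝒢) : TJPolyTimeSolvable 𝒢 := by
  obtain ⟨q, hq⟩ := h𝒢
  have hM := Bound.poly inputCtx (q + 1)
  have hA := CompSet.card bound_input_n compSet_input_A
  obtain ⟨p, T, h⟩ := CompP.exists_decidesWithin
    ((hA.eq (CompSet.card bound_input_n compSet_input_B)).and
      (CompP.linked_rows bound_input_n hM compRel_input_adj comp_input_s comp_input_t
        compSet_input_A compSet_input_B (hA.add (Comp.const _ 1))))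
  refine ⟨p, T, fun n G hG s t A B hA hB => ?_⟩
  obtain ⟨τ, σ', h1, h2, h3⟩ := h ⟨n, G, s, t, A, B, 0⟩
  refine ⟨τ, σ', h1, h2, h3.trans ?_⟩
  rw [TJ_iff_TAR hA hB]
  refine and_congr_right fun hcard => ?_
  exact linked_iff_TAR hA hB (Nat.le_succ _) (by simp only at hcard ⊢; omega)
    (isMinSeparator_iff_exists_row hA.ne hA.not_adj
      ((hq n G hG).trans_lt (by simp [inputCtx])))

end Tame

end SepReconf

theorem mainTheorem4 (𝒢 : SepReconf.GraphClass) (h𝒢 : SepReconf.Tame 𝒢) :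
    SepReconf.TARPolyTimeSolvable 𝒢 ∧ SepReconf.TJPolyTimeSolvable 𝒢 ∧
    -- the criterion that is checked: connectivity in the graph on the minimal separators
    ∀ (n : ℕ) (G : SimpleGraph (Fin n)), G ∈ 𝒢 n →
      ∀ (u v : Fin n) (A B : Finset (Fin n)) (k : ℕ),
        SepReconf.IsSeparator G u v A → SepReconf.IsSeparator G u v B →
        A.card ≤ k → B.card ≤ k →
        ∀ A' B' : {S : Finset (Fin n) // SepReconf.IsMinSeparator G u v S},
          A'.1 ⊆ A → B'.1 ⊆ B →
          (SepReconf.TAR G u v A B k ↔ (SepReconf.overlapGraph G u v k).Reachable A' B') := by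
  refine ⟨SepReconf.TAR_polyTimeSolvable h𝒢, SepReconf.TJ_polyTimeSolvable h𝒢, ?_⟩
  intro n G _ u v A B k hA hB hAk hBk A' B' hA' hB'
  exact SepReconf.TAR_iff_reachable hA hB hAk hBk A' B' hA' hB'
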